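/- **Theorem (extension of the spectral gap).** Let $a_i>0$ ($i\ge 1$), $b_i>0$ ($i\ge 2$), $b_1=0$, and define $Q_1=1$, $Q_{i+1}=\frac{a_i}{b_{i+1}}Q_i$. Let $z_s\in[0,+\infty]$ be the largest number such that $\sum_{i\ge1} iQ_ix^i<\infty$ for all $0\le x<z_s$. Let $0<z<z_s$ and put $\mathcal Q_i=Q_iz^i$. Assume $$\sum_{i\ge1} i^2(1+a_i+b_i)^2\mathcal Q_i<\infty,\qquad \inf_{i\ge1}a_i>0,\qquad \lim_{i\to\infty}\frac{Q_{i+1}}{Q_i}=\frac1{z_s},\qquad \lim_{i\to\infty}\frac{a_{i+1}}{a_i}=1,$$ with the convention $1/\infty=0$. For a real sequence $h=(h_i)_{i\ge1}$ set $W_i=W_i(h)=a_i\mathcal Q_i\mathcal Q_1(h_i+h_1-h_{i+1})$ and $$L_1(h)=-\frac1{\mathcal Q_1}\Big(W_1+\sum_{k\ge1}W_k\Big),\qquad L_i(h)=\frac1{\mathcal Q_i}(W_{i-1}-W_i)\quad(i\ge2).$$ Let $\lambda_0$ be the size of the spectral gap of $L$ in $\ell^2(\mathcal Q)$, i.e.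 the largest $\lambda\ge0$ such that $\sum_i\mathcal Q_ih_iL_i(h)\le-\lambda\sum_i\mathcal Q_ih_i^2$ for all finitely supported $h$ with $\sum_i i\mathcal Q_ih_i=0$. Let $0<\eta<\frac12\log\frac{z_s}{z}$ (any $\eta>0$ if $z_s=+\infty$), let $X$ be the Banach space of real sequences with $\|h\|_X=\sum_ie^{\eta i}\mathcal Q_i|h_i|<\infty$, and let $X_1\subset X$ be the subspace of those $h$ with $\sum_i(1+\sigma_i)e^{\eta i}\mathcal Q_i|h_i|<\infty$, where $\sigma_1=3a_1\mathcal Q_1+\sum_{k\ge 1} a_k\mathcal Q_k$ and $\sigma_i=a_i\mathcal Q_1+b_i$ for $i\ge2$. Then for every $h\in X_1$ the series $\sum_kW_k(h)$ converges absolutely and $L(h)\in X$, so that $\Lambda h:=L(h)$ defines a linear operator $\Lambda$ on $X$ with domain $X_1$. The operator $\Lambda$, with domain $X_1$, is the generator of a strongly continuous semigroup $(e^{t\Lambda})_{t\ge0}$ on $X$. There exist $0<\lambda_\star\le\lambda_0$ and $C>0$ such that $$\|e^{t\Lambda}g\|_X\le Ce^{-\lambda_\star t}\|g\|_X\qquad\text{for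 all }t\ge0\text{ and all }g\in X\text{ with }\sum_{i\ge1}i\mathcal Q_ig_i=0.$$ If in addition $\lim_{i\to\infty}a_i=+\infty$, the same estimate holds with $\lambda_\star=\lambda_0$, for some $C>0$. -/

import Mathlib

open Filter Topology
open scoped ENNReal NNReal

noncomputable section

/-- Becker–Döring coagulation coefficients `a i` (`i ≥ 1`) and fragmentation coefficients `b i`
(`i ≥ 2`, with the convention `b 1 = 0`), all strictly positive, together with an equilibrium
monomer density `z > 0`. -/
structure BeckerDoring where
  a : ℕ+ → ℝ
  b : ℕ+ → ℝ
  z : ℝ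
  a_pos : ∀ i, 0 < a i
  b_one : b 1 = 0
  b_pos : ∀ i, 1 < i → 0 < b i
  z_pos : 0 < z

namespace BeckerDoring

variable (S : BeckerDoring)

/-- Detailed balance coefficients: `Q 1 = 1`, `Q (i + 1) = a i / b (i + 1) * Q i`. -/
def Q (i : ℕ+) : ℝ := PNat.recOn i 1 fun j q => S.a j / S.b (j + 1) * q

/-- The critical monomer density: the largest `r ∈ [0, ∞]` such that `∑ i Q_i x ^ i < ∞` for
all `0 ≤ x < r`. -/
def zs : ℝ≥0∞ :=
  sSup {r : ℝ≥0∞ | ∀ x : ℝ≥0, (x : ℝ≥0∞) < r →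
    Summable fun i : ℕ+ => (i : ℝ) * S.Q i * (x : ℝ) ^ (i : ℕ)}

/-- The equilibrium `𝒬_i = Q_i z ^ i`. -/
def Qz (i : ℕ+) : ℝ := S.Q i * S.z ^ (i : ℕ)

/-- The linearized fluxes `W_i = a_i 𝒬_i 𝒬_1 (h_i + h_1 - h_{i+1})`. -/
def W (h : ℕ+ → ℝ) (i : ℕ+) : ℝ := S.a i * S.Qz i * S.Qz 1 * (h i + h 1 - h (i + 1))

/-- The linearized operator in strong form: `L_1(h) = -(W_1 + ∑_k W_k) / 𝒬_1` and
`L_i(h) = (W_{i-1} - W_i) / 𝒬_i` for `i ≥ 2`. -/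
def L (h : ℕ+ → ℝ) (i : ℕ+) : ℝ :=
  if i = 1 then -(1 / S.Qz 1) * (S.W h 1 + ∑' k, S.W h k)
  else 1 / S.Qz i * (S.W h (i - 1) - S.W h i)

/-- `σ_1 = 3 a_1 𝒬_1 + ∑_i a_i 𝒬_i` and `σ_i = a_i 𝒬_1 + b_i` for `i ≥ 2`. -/
def sigma (i : ℕ+) : ℝ :=
  if i = 1 then 3 * S.a 1 * S.Qz 1 + ∑' k, S.a k * S.Qz k else S.a i * S.Qz 1 + S.b i

/-- The size `λ₀` of the spectral gap of the linearized operator in `ℓ²(𝒬)`: the largest `l ≥ 0`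
with `⟨h, L h⟩ ≤ -l ‖h‖²` for all finitely supported `h` of zero mass `∑ i 𝒬_i h_i`. -/
def spectralGap : ℝ :=
  sSup {l : ℝ | 0 ≤ l ∧ ∀ h : ℕ+ → ℝ, h.support.Finite → ∑' i : ℕ+, (i : ℝ) * S.Qz i * h i = 0 →
    ∑' i, S.Qz i * (h i * S.L h i) ≤ -l * ∑' i, S.Qz i * h i ^ 2}

/-- The weights `e ^ (η i) 𝒬_i`. -/
def weight (η : ℝ) (i : ℕ+) : ℝ := Real.exp (η * (i : ℝ)) * S.Qz i

theorem Q_pos (i : ℕ+) : 0 < S.Q i := by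
  induction i using PNat.recOn with
  | one => simp [Q]
  | succ n ih =>
    have hb : 0 < S.b (n + 1) := S.b_pos _ (PNat.lt_add_left 1 n)
    have : S.Q (n + 1) = S.a n / S.b (n + 1) * S.Q n := by simp [Q]
    rw [this]
    exact mul_pos (div_pos (S.a_pos n) hb) ih

theorem weight_pos (η : ℝ) (i : ℕ+) : 0 < S.weight η i :=
  mul_pos (Real.exp_pos _) (mul_pos (S.Q_pos i) (pow_pos S.z_pos _))

/-- The sequences `h` with `∑ w_i |h_i| < ∞`. -/
def weightedL1 (w : ℕ+ → ℝ) : Submodule ℝ (ℕ+ → ℝ) where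
  carrier := {h | Summable fun i => |w i| * |h i|}
  zero_mem' := by simp
  add_mem' := by
    intro f g hf hg
    refine Summable.of_nonneg_of_le (fun i => by positivity) (fun i => ?_) (hf.add hg)
    rw [← mul_add]
    exact mul_le_mul_of_nonneg_left (abs_add_le _ _) (abs_nonneg _)
  smul_mem' := by
    intro c f hf
    refine (hf.mul_left |c|).congr fun i => ?_
    simp only [Pi.smul_apply, smul_eq_mul, abs_mul]
    ring

/-- The space `X = ℓ¹(e ^ (η i) 𝒬_i)`; a type of its own, so that it carries the topology of its
norm and not the product topology. -/
def X (η : ℝ) : Type := ↥(weightedL1 (S.weight η))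

instance (η : ℝ) : AddCommGroup (S.X η) := inferInstanceAs (AddCommGroup ↥(weightedL1 (S.weight η)))

instance (η : ℝ) : Module ℝ (S.X η) := inferInstanceAs (Module ℝ ↥(weightedL1 (S.weight η)))

instance (η : ℝ) : CoeFun (S.X η) fun _ => ℕ+ → ℝ := ⟨fun h => h.1⟩

/-- `‖h‖_X = ∑ e ^ (η i) 𝒬_i |h_i|`. -/
instance (η : ℝ) : Norm (S.X η) := ⟨fun h => ∑' i, S.weight η i * |h i|⟩

theorem X_summable {η : ℝ} (h : S.X η) : Summable fun i => S.weight η i * |h i| :=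
  h.2.congr fun i => by rw [abs_of_pos (S.weight_pos η i)]

theorem X_core (η : ℝ) : NormedSpace.Core ℝ (S.X η) where
  norm_nonneg h := tsum_nonneg fun i => mul_nonneg (S.weight_pos η i).le (abs_nonneg _)
  norm_smul c h := by
    change ∑' i, S.weight η i * |c * h i| = |c| * ∑' i, S.weight η i * |h i|
    rw [← tsum_mul_left]
    refine tsum_congr fun i => ?_
    rw [abs_mul]
    ring
  norm_triangle f g := by
    change ∑' i, S.weight η i * |f i + g i| ≤
      ∑' i, S.weight η i * |f i| + ∑' i, S.weight η i * |g i|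
    rw [← (S.X_summable f).tsum_add (S.X_summable g)]
    refine (S.X_summable (f + g)).tsum_le_tsum (fun i => ?_)
      ((S.X_summable f).add (S.X_summable g))
    rw [← mul_add]
    exact mul_le_mul_of_nonneg_left (abs_add_le _ _) (S.weight_pos η i).le
  norm_eq_zero_iff h := by
    change ∑' i, S.weight η i * |h i| = 0 ↔ h = 0
    constructor
    · intro h0
      have h1 := (hasSum_zero_iff_of_nonneg
        (fun i => mul_nonneg (S.weight_pos η i).le (abs_nonneg (h i)))).1
        (h0 ▸ (S.X_summable h).hasSum)
      refine Subtype.ext (funext fun i => ?_)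
      have h2 : S.weight η i * |h i| = 0 := congrFun h1 i
      exact abs_eq_zero.1 ((mul_eq_zero.1 h2).resolve_left (S.weight_pos η i).ne')
    · rintro rfl
      change ∑' i, S.weight η i * |(0 : ℝ)| = 0
      simp

instance (η : ℝ) : NormedAddCommGroup (S.X η) := NormedAddCommGroup.ofCore (S.X_core η)

instance (η : ℝ) : NormedSpace ℝ (S.X η) := NormedSpace.ofCore (S.X_core η)

/-- The subspace `X₁ = ℓ¹((1 + σ_i) e ^ (η i) 𝒬_i)` of `X`. -/
def X1 (η : ℝ) : Submodule ℝ (S.X η) :=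
  (weightedL1 fun i => (1 + S.sigma i) * S.weight η i).comap
    (weightedL1 (S.weight η)).subtype

end BeckerDoring

/-- A strongly continuous semigroup of bounded operators on `E`. -/
structure C0Semigroup (E : Type*) [NormedAddCommGroup E] [NormedSpace ℝ E] where
  op : ℝ≥0 → E →L[ℝ] E
  op_zero : op 0 = ContinuousLinearMap.id ℝ E
  op_add : ∀ s t, op (s + t) = (op s).comp (op t)
  continuous_op : ∀ x, Continuous fun t => op t x

/-- `A` (with its domain) is the infinitesimal generator of `T`: `x` lies in the domain of `A` and
`A x = y` if and only if `(T_t x - x) / t → y` as `t → 0⁺`. -/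
def C0Semigroup.IsGenerator {E : Type*} [NormedAddCommGroup E] [NormedSpace ℝ E]
    (T : C0Semigroup E) (A : E →ₗ.[ℝ] E) : Prop :=
  ∀ x y : E, (x, y) ∈ A.graph ↔
    Tendsto (fun t : ℝ≥0 => (t : ℝ)⁻¹ • (T.op t x - x)) (𝓝[>] 0) (𝓝 y)

end

/-!
Write `w_i = e ^ (η i) 𝒬_i`. In the weighted `ℓ¹` space `X`, the diagonal of the linearized operator
is essentially `-σ_i`, and the weighted sum of the off-diagonal entries of the column `i` is at most
`κ σ_i` with `κ < 1` for large `i`: the two neighbours contribute `e ^ (-η) b_i + e ^ η a_i z`,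
which falls short of `b_i + a_i z` by a fixed factor because `b_i ≥ e ^ (2 η) a_i z` for large `i`,
and the contribution of the column to the equation of the monomers carries the small factor
`e ^ (-η i)` (`Subcritical.exists_offDiag_le`, `Subcritical.exists_colSum_le`). A Neumann
series therefore inverts `l - Λ` on all of `X`, with range exactly `X₁`, for large `l`
(`IsGainBound.exists_resolvent`).

The decay is proved for the powers of the resolvent `R_l`, not for the semigroup. Adding a large
constant to the diagonal in finitely many coordinates gives an operator `B = Λ - A` that is
dissipative in `X` at a rate `μ` (`IsGainBound.exists_dissipative`); `μ` can be any number below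
`(1 - κ) liminf σ_i`, hence is positive in general and arbitrarily large if `a_i → ∞`. The
perturbation `A` maps `X` into `ℓ²(𝒬)`, which embeds into `X` because `2 η < log (z_s / z)`. On the
sequences of zero mass in `ℓ²(𝒬)`, `R_l` is bounded by `1 / (l + λ₀)`. This is the spectral gap, for
which one needs that the solution in `X` lies in `ℓ²(𝒬)`: it is the limit of Galerkin
approximations, for which the energy estimate holds up to an error that tends to zero
(`Subcritical.energy_bound`, `Subcritical.exists_iota_eq_of_galerkin`). Splitting a sequence of zero
mass into a part in `X` evolving by `B` and a part in `ℓ²(𝒬)` fed by `A`, one finds that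
`R_l ^ k` decays like `(l + r) ^ (-k)` for every `r ≤ λ₀` with `r < μ`, uniformly in `l`
(`exists_norm_resolvent_pow_le`). In particular `r = λ₀` is allowed if `a_i → ∞`.

The powers of `R_l` are thus bounded as in the Hille–Yosida theorem, which yields the semigroup as
the limit of the exponentials of the Yosida approximations, and the decay passes to that limit
(`IsBoundedResolvent.exists_semigroup`, `norm_le_of_tendsto_exp_yosida`). That `λ₀ > 0` follows from
a discrete Hardy inequality (`Subcritical.exists_hardy`).
-/

noncomputable section

/-! ### The Hille–Yosida theorem -/

section HilleYosida

variable {E : Type*} [NormedAddCommGroup E] [NormedSpace ℝ E]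

/-- `R l`, `l > ω`, is a two-sided inverse of `l - A`, and `‖R l ^ k‖ ≤ M / l ^ k`: the hypotheses
of the Hille–Yosida theorem, for a semigroup bounded by `M`. The operator `A` enters through its
graph. -/
structure IsBoundedResolvent (A : E →ₗ.[ℝ] E) (ω M : ℝ) (R : ℝ → E →L[ℝ] E) : Prop where
  nonneg : 0 ≤ ω
  right_inv : ∀ l, ω < l → ∀ x, (R l x, l • R l x - x) ∈ A.graph
  left_inv : ∀ l, ω < l → ∀ x y, (x, y) ∈ A.graph → R l (l • x - y) = x
  bound : ∀ l, ω < l → ∀ k : ℕ, ∀ x, ‖(R l ^ k) x‖ ≤ M * ‖x‖ * (l⁻¹) ^ k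

/-- The Yosida approximation `n A R n = n ^ 2 R n - n` of an operator `A` with resolvent `R`. -/
def yosida (R : ℝ → E →L[ℝ] E) (n : ℕ) : E →L[ℝ] E := ((n : ℝ) ^ 2) • R n - (n : ℝ) • 1

theorem norm_exp_smul_apply_le [CompleteSpace E] (B : E →L[ℝ] E) (x : E) {C r : ℝ}
    (hB : ∀ k : ℕ, ‖(B ^ k) x‖ ≤ C * r ^ k) {s : ℝ} (hs : 0 ≤ s) :
    ‖NormedSpace.exp (s • B) x‖ ≤ C * Real.exp (s * r) := by
  have h1 := NormedSpace.exp_series_hasSum_exp' (𝕂 := ℝ) (s • B)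
  have h2 : HasSum (fun n : ℕ => ((n.factorial : ℝ)⁻¹ • (s • B) ^ n) x)
      (NormedSpace.exp (s • B) x) :=
    h1.mapL (ContinuousLinearMap.apply ℝ E x)
  have h3 : HasSum (fun n : ℕ => C * ((n.factorial : ℝ)⁻¹ • (s * r) ^ n))
      (C * Real.exp (s * r)) := by
    rw [Real.exp_eq_exp_ℝ]
    exact (NormedSpace.exp_series_hasSum_exp' (𝕂 := ℝ) (s * r)).mul_left C
  refine h2.norm_le_of_bounded h3 fun n => ?_
  rw [smul_pow, smul_apply, smul_apply, norm_smul,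
    norm_smul, Real.norm_of_nonneg (by positivity), Real.norm_of_nonneg (by positivity), mul_pow,
    smul_eq_mul]
  calc (n.factorial : ℝ)⁻¹ * (s ^ n * ‖(B ^ n) x‖)
      ≤ (n.factorial : ℝ)⁻¹ * (s ^ n * (C * r ^ n)) := by gcongr; exact hB n
    _ = _ := by ring

theorem exp_smul_sub_smul_one [CompleteSpace E] (B : E →L[ℝ] E) (c d : ℝ) :
    NormedSpace.exp (d • B - c • 1) = Real.exp (-c) • NormedSpace.exp (d • B) := by
  let _ : NormedAlgebra ℚ (E →L[ℝ] E) := NormedAlgebra.restrictScalars ℚ ℝ _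
  have hc : Commute (d • B) (-(c • (1 : E →L[ℝ] E))) :=
    ((Commute.one_right _).smul_right c).neg_right
  rw [sub_eq_add_neg, NormedSpace.exp_add_of_commute hc]
  have h1 : NormedSpace.exp (-(c • (1 : E →L[ℝ] E))) = Real.exp (-c) • (1 : E →L[ℝ] E) := by
    have := NormedSpace.algebraMap_exp_comm (𝕂 := ℝ) (𝔸 := E →L[ℝ] E) (-c)
    rw [Algebra.algebraMap_eq_smul_one, Algebra.algebraMap_eq_smul_one, ← Real.exp_eq_exp_ℝ] at this
    rw [← neg_smul, ← this]
  rw [h1, mul_smul_comm, mul_one]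

theorem norm_exp_yosida_apply_le [CompleteSpace E] (R : ℝ → E →L[ℝ] E) (x : E) {C r : ℝ} {n : ℕ}
    (h : ∀ k : ℕ, ‖(R n ^ k) x‖ ≤ C * r ^ k) {t : ℝ} (ht : 0 ≤ t) :
    ‖NormedSpace.exp (t • yosida R n) x‖ ≤ C * Real.exp (t * (n ^ 2 * r - n)) := by
  have h1 : t • yosida R n = (t * n ^ 2) • R n - (t * n) • (1 : E →L[ℝ] E) := by
    simp [yosida, smul_sub, smul_smul]
  rw [h1, exp_smul_sub_smul_one, smul_apply, norm_smul,
    Real.norm_of_nonneg (Real.exp_pos _).le]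
  calc _ ≤ Real.exp (-(t * n)) * (C * Real.exp (t * n ^ 2 * r)) := by
        gcongr; exact norm_exp_smul_apply_le _ _ h (by positivity)
    _ = C * Real.exp (t * (n ^ 2 * r - n)) := by
        rw [mul_left_comm, ← Real.exp_add]; ring_nf

theorem exp_add_smul_apply [CompleteSpace E] (B : E →L[ℝ] E) (s t : ℝ) (x : E) :
    NormedSpace.exp ((s + t) • B) x = NormedSpace.exp (s • B) (NormedSpace.exp (t • B) x) := by
  let _ : NormedAlgebra ℚ (E →L[ℝ] E) := NormedAlgebra.restrictScalars ℚ ℝ _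
  rw [add_smul, NormedSpace.exp_add_of_commute (((Commute.refl B).smul_left s).smul_right t)]
  rfl

theorem hasDerivAt_exp_smul_apply [CompleteSpace E] (B : E →L[ℝ] E) (x : E) (t : ℝ) :
    HasDerivAt (fun s : ℝ => NormedSpace.exp (s • B) x) (NormedSpace.exp (t • B) (B x)) t := by
  have := (hasDerivAt_exp_smul_const (𝕂 := ℝ) B t).clm_apply (hasDerivAt_const t x)
  simpa using this

/-- Two commuting bounded operators that generate semigroups bounded by `M` generate close
semigroups where the operators are close. -/
theorem norm_exp_sub_exp_le [CompleteSpace E] {A B : E →L[ℝ] E} (hAB : Commute A B) {M : ℝ}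
    (hM : 0 ≤ M)
    (hA : ∀ s : ℝ, 0 ≤ s → ∀ x, ‖NormedSpace.exp (s • A) x‖ ≤ M * ‖x‖)
    (hB : ∀ s : ℝ, 0 ≤ s → ∀ x, ‖NormedSpace.exp (s • B) x‖ ≤ M * ‖x‖) {t : ℝ} (ht : 0 ≤ t)
    (x : E) :
    ‖NormedSpace.exp (t • A) x - NormedSpace.exp (t • B) x‖ ≤ M ^ 2 * ‖A x - B x‖ * t := by
  let _ : NormedAlgebra ℚ (E →L[ℝ] E) := NormedAlgebra.restrictScalars ℚ ℝ _
  -- The path `s ↦ e ^ (s A) e ^ ((t - s) B) x` joins the two vectors.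
  have hd : ∀ s : ℝ, HasDerivAt
      (fun s : ℝ => NormedSpace.exp (s • A) (NormedSpace.exp ((t - s) • B) x))
      (NormedSpace.exp (s • A) (NormedSpace.exp ((t - s) • B) (A x - B x))) s := by
    intro s
    have h1 : HasDerivAt (fun s : ℝ => NormedSpace.exp ((t - s) • B) x)
        (-(NormedSpace.exp ((t - s) • B) (B x))) s := by
      have h := (hasDerivAt_exp_smul_apply B x (t - s)).scomp s ((hasDerivAt_id s).const_sub t)
      simpa [Function.comp_def] using h
    have h2 := (hasDerivAt_exp_smul_const (𝕂 := ℝ) A s).clm_apply h1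
    refine h2.congr_deriv ?_
    have h3 : Commute A (NormedSpace.exp ((t - s) • B)) := (hAB.smul_right _).exp_right
    have h4 : A (NormedSpace.exp ((t - s) • B) x) = NormedSpace.exp ((t - s) • B) (A x) :=
      congrArg (fun T : E →L[ℝ] E => T x) h3.eq
    rw [mul_apply_eq_comp, h4, map_neg, map_sub, map_sub]
    abel
  have h := norm_image_sub_le_of_norm_deriv_le_segment'
    (C := M ^ 2 * ‖A x - B x‖) (a := 0) (b := t)
    (fun s _ => (hd s).hasDerivWithinAt) (fun s hs => ?_) t ⟨ht, le_rfl⟩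
  · simpa using h
  · refine (hA s hs.1 _).trans ?_
    rw [sq, mul_assoc]
    exact mul_le_mul_of_nonneg_left (hB _ (by linarith [hs.2]) _) hM

namespace IsBoundedResolvent

variable {A : E →ₗ.[ℝ] E} {ω M : ℝ} {R : ℝ → E →L[ℝ] E}

theorem resolvent_identity (h : IsBoundedResolvent A ω M R) {l m : ℝ} (hl : ω < l) (hm : ω < m)
    (x : E) : R m x = R l x + (l - m) • R l (R m x) := by
  have h1 := h.left_inv l hl _ _ (h.right_inv m hm x)
  simp only [map_sub, map_smul] at h1
  calc R m x = l • R l (R m x) - (m • R l (R m x) - R l x) := h1.symm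
    _ = _ := by module

theorem commute (h : IsBoundedResolvent A ω M R) {l m : ℝ} (hl : ω < l) (hm : ω < m) :
    Commute (R l) (R m) := by
  rcases eq_or_ne l m with rfl | hlm
  · exact Commute.refl _
  ext x
  have h1 := h.resolvent_identity hl hm x
  have h2 := h.resolvent_identity hm hl x
  have h3 : (l - m) • (R l (R m x) - R m (R l x)) = 0 := by
    have h4 : (l - m) • R l (R m x) = R m x - R l x := eq_sub_of_add_eq' h1.symm
    have h5 : (m - l) • R m (R l x) = R l x - R m x := eq_sub_of_add_eq' h2.symm
    have h6 : (l - m) • (R l (R m x) - R m (R l x))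
        = (l - m) • R l (R m x) + (m - l) • R m (R l x) := by module
    rw [h6, h4, h5]; abel
  exact sub_eq_zero.1 ((smul_eq_zero.1 h3).resolve_left (sub_ne_zero.2 hlm))

theorem commute_yosida (h : IsBoundedResolvent A ω M R) {l : ℝ} (hl : ω < l) {n : ℕ}
    (hn : ω < n) : Commute (R l) (yosida R n) :=
  ((h.commute hl hn).smul_right _).sub_right ((Commute.one_right _).smul_right _)

theorem commute_yosida_yosida (h : IsBoundedResolvent A ω M R) {m n : ℕ} (hm : ω < m)
    (hn : ω < n) : Commute (yosida R m) (yosida R n) :=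
  ((h.commute_yosida hm hn).smul_left _).sub_left ((Commute.one_left _).smul_left _)

theorem eventually_lt (ω : ℝ) : ∀ᶠ n : ℕ in atTop, ω < n :=
  tendsto_natCast_atTop_atTop.eventually_gt_atTop ω

theorem yosida_apply (h : IsBoundedResolvent A ω M R) {n : ℕ} (hn : ω < n) {x y : E}
    (hxy : (x, y) ∈ A.graph) : yosida R n x = (n : ℝ) • R n y := by
  have h1 := h.left_inv n hn x y hxy
  rw [map_sub, map_smul] at h1
  have h2 : R n y = (n : ℝ) • R n x - x := (sub_eq_iff_eq_add.1 h1).symm ▸ by abel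
  simp only [yosida, sub_apply, smul_apply, one_apply_eq_self]
  rw [h2]
  module

theorem tendsto_smul_resolvent (h : IsBoundedResolvent A ω M R) (hM : 0 ≤ M)
    (hd : Dense (A.domain : Set E)) (x : E) :
    Tendsto (fun n : ℕ => (n : ℝ) • R n x) atTop (𝓝 x) := by
  have hbd : ∀ n : ℕ, ω < n → ∀ v, ‖(n : ℝ) • R n v‖ ≤ M * ‖v‖ := by
    intro n hn v
    have hn0 : (0 : ℝ) < n := h.nonneg.trans_lt hn
    have := h.bound n hn 1 v
    rw [pow_one, pow_one] at this
    rw [norm_smul, Real.norm_of_nonneg hn0.le]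
    calc (n : ℝ) * ‖R n v‖ ≤ n * (M * ‖v‖ * (n : ℝ)⁻¹) := by gcongr
      _ = M * ‖v‖ := by field_simp
  rw [Metric.tendsto_nhds]
  intro ε hε
  obtain ⟨y, hy, hxy⟩ := Metric.mem_closure_iff.1 (hd x) (ε / (2 * (M + 1))) (by positivity)
  obtain ⟨w, hw⟩ : ∃ w, (y, w) ∈ A.graph := ⟨A ⟨y, hy⟩, A.mem_graph ⟨y, hy⟩⟩
  have h1 : Tendsto (fun n : ℕ => M * ‖w‖ / (n : ℝ)) atTop (𝓝 0) :=
    tendsto_const_div_atTop_nhds_zero_nat _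
  filter_upwards [eventually_lt ω, h1.eventually_lt_const (half_pos hε)] with n hn hsmall
  have hn0 : (0 : ℝ) < n := h.nonneg.trans_lt hn
  have h2 : (n : ℝ) • R n y - y = R n w := by
    have := h.left_inv n hn y w hw
    rw [map_sub, map_smul] at this
    rw [← sub_eq_zero] at this ⊢
    rw [← this]; abel
  have h3 : ‖R n w‖ ≤ M * ‖w‖ / n := by
    have := h.bound n hn 1 w
    simpa [div_eq_mul_inv] using this
  have h4 : (n : ℝ) • R n x - x = (n : ℝ) • R n (x - y) + R n w - (x - y) := by
    rw [← h2, map_sub]; module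
  rw [dist_eq_norm, h4]
  have h5 : ‖x - y‖ < ε / (2 * (M + 1)) := by rwa [← dist_eq_norm]
  calc _ ≤ ‖(n : ℝ) • R n (x - y)‖ + ‖R n w‖ + ‖x - y‖ :=
        (norm_sub_le _ _).trans (by gcongr; exact norm_add_le _ _)
    _ ≤ M * ‖x - y‖ + M * ‖w‖ / n + ‖x - y‖ := by gcongr; exact hbd n hn _
    _ = (M + 1) * ‖x - y‖ + M * ‖w‖ / n := by ring
    _ < (M + 1) * (ε / (2 * (M + 1))) + ε / 2 := by gcongr
    _ = ε := by field_simp; ring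

theorem tendsto_yosida (h : IsBoundedResolvent A ω M R) (hM : 0 ≤ M)
    (hd : Dense (A.domain : Set E)) {x y : E} (hxy : (x, y) ∈ A.graph) :
    Tendsto (fun n : ℕ => yosida R n x) atTop (𝓝 y) := by
  refine (h.tendsto_smul_resolvent hM hd y).congr' ?_
  filter_upwards [eventually_lt ω] with n hn
  exact (h.yosida_apply hn hxy).symm

theorem norm_exp_yosida_le [CompleteSpace E] (h : IsBoundedResolvent A ω M R) {n : ℕ}
    (hn : ω < n) {t : ℝ} (ht : 0 ≤ t) (x : E) :
    ‖NormedSpace.exp (t • yosida R n) x‖ ≤ M * ‖x‖ := by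
  have hn0 : (0 : ℝ) < n := h.nonneg.trans_lt hn
  have := norm_exp_yosida_apply_le R x (h.bound n hn · x) ht
  have h0 : (n : ℝ) ^ 2 * (n : ℝ)⁻¹ - n = 0 := by field_simp; ring
  simpa [h0] using this

theorem cauchySeq_exp_yosida [CompleteSpace E] (h : IsBoundedResolvent A ω M R) (hM : 0 ≤ M)
    (hd : Dense (A.domain : Set E)) {t : ℝ} (ht : 0 ≤ t) (x : E) :
    CauchySeq fun n : ℕ => NormedSpace.exp (t • yosida R n) x := by
  rw [Metric.cauchySeq_iff']
  intro ε hε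
  obtain ⟨y, hy, hxy⟩ := Metric.mem_closure_iff.1 (hd x) (ε / (4 * (M + 1))) (by positivity)
  obtain ⟨w, hw⟩ : ∃ w, (y, w) ∈ A.graph := ⟨A ⟨y, hy⟩, A.mem_graph ⟨y, hy⟩⟩
  have hc := (h.tendsto_yosida hM hd hw).cauchySeq
  obtain ⟨N, hN⟩ := Metric.cauchySeq_iff.1 hc (ε / (2 * (M ^ 2 + 1) * (t + 1))) (by positivity)
  obtain ⟨N', hN'⟩ := (eventually_lt ω).exists_forall_of_atTop
  refine ⟨max N N', fun n hn => ?_⟩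
  set m := max N N'
  have hnω := hN' n (le_of_max_le_right hn)
  have hmω := hN' m (le_max_right _ _)
  have h1 := norm_exp_sub_exp_le (h.commute_yosida_yosida hnω hmω) hM
    (fun s hs x => h.norm_exp_yosida_le hnω hs x) (fun s hs x => h.norm_exp_yosida_le hmω hs x) ht y
  have h2 := hN n (le_of_max_le_left hn) m (le_max_left _ _)
  rw [dist_eq_norm] at h2 hxy
  have e1 : NormedSpace.exp (t • yosida R n) x - NormedSpace.exp (t • yosida R m) x
      = (NormedSpace.exp (t • yosida R n) y - NormedSpace.exp (t • yosida R m) y)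
        + (NormedSpace.exp (t • yosida R n) (x - y)
          - NormedSpace.exp (t • yosida R m) (x - y)) := by
    rw [map_sub, map_sub]; abel
  rw [dist_eq_norm, e1]
  have h3 := h.norm_exp_yosida_le hnω ht (x - y)
  have h4 := h.norm_exp_yosida_le hmω ht (x - y)
  have h5 : M ^ 2 * ‖yosida R n y - yosida R m y‖ * t ≤ ε / 2 := by
    calc _ ≤ (M ^ 2 + 1) * (ε / (2 * (M ^ 2 + 1) * (t + 1))) * (t + 1) := by gcongr <;> linarith
      _ = ε / 2 := by field_simp
  have h6 : (M + 1) * ‖x - y‖ < ε / 4 := by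
    calc _ < (M + 1) * (ε / (4 * (M + 1))) := by gcongr
      _ = ε / 4 := by field_simp
  have h7 := norm_add_le
    (NormedSpace.exp (t • yosida R n) y - NormedSpace.exp (t • yosida R m) y)
    (NormedSpace.exp (t • yosida R n) (x - y) - NormedSpace.exp (t • yosida R m) (x - y))
  have h8 := norm_sub_le (NormedSpace.exp (t • yosida R n) (x - y))
    (NormedSpace.exp (t • yosida R m) (x - y))
  linarith [norm_nonneg (x - y)]

/-- The **Hille–Yosida theorem**. The semigroup is the strong limit of the exponentials of the
Yosida approximations, which carries estimates on the powers of the resolvent over to it. -/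
theorem exists_semigroup [CompleteSpace E] (h : IsBoundedResolvent A ω M R) (hM : 0 ≤ M)
    (hd : Dense (A.domain : Set E)) :
    ∃ T : C0Semigroup E, T.IsGenerator A ∧ ∀ (t : ℝ≥0) (x : E),
      Tendsto (fun n : ℕ => NormedSpace.exp ((t : ℝ) • yosida R n) x) atTop (𝓝 (T.op t x)) := by
  have hlim : ∀ (t : ℝ≥0) (x : E), ∃ y,
      Tendsto (fun n : ℕ => NormedSpace.exp ((t : ℝ) • yosida R n) x) atTop (𝓝 y) := fun t x =>
    cauchySeq_tendsto_of_complete (h.cauchySeq_exp_yosida hM hd t.2 x)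
  choose T hT using hlim
  have hTbd : ∀ t x, ‖T t x‖ ≤ M * ‖x‖ := fun t x =>
    le_of_tendsto (hT t x).norm (by
      filter_upwards [eventually_lt ω] with n hn using h.norm_exp_yosida_le hn t.2 x)
  let op : ℝ≥0 → E →L[ℝ] E := fun t => LinearMap.mkContinuous
    { toFun := T t
      map_add' := fun x y => tendsto_nhds_unique (hT t (x + y))
        (((hT t x).add (hT t y)).congr fun n => (map_add _ _ _).symm)
      map_smul' := fun c x => tendsto_nhds_unique (hT t (c • x))
        (((hT t x).const_smul c).congr fun n => (map_smul _ _ _).symm) } M (hTbd t)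
  have hop : ∀ (t : ℝ≥0) (x : E),
      Tendsto (fun n : ℕ => NormedSpace.exp ((t : ℝ) • yosida R n) x) atTop
      (𝓝 (op t x)) := hT
  have hopbd : ∀ t x, ‖op t x‖ ≤ M * ‖x‖ := hTbd
  have hadd : ∀ s t, op (s + t) = (op s).comp (op t) := by
    intro s t
    ext x
    have h1 : Tendsto (fun n : ℕ => NormedSpace.exp ((s : ℝ) • yosida R n)
        (NormedSpace.exp ((t : ℝ) • yosida R n) x - op t x)) atTop (𝓝 0) := by
      have h2 : Tendsto (fun n : ℕ => M * ‖NormedSpace.exp ((t : ℝ) • yosida R n) x - op t x‖)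
          atTop (𝓝 0) := by
        simpa using (tendsto_iff_norm_sub_tendsto_zero.1 (hop t x)).const_mul M
      refine squeeze_zero_norm' ?_ h2
      filter_upwards [eventually_lt ω] with n hn using h.norm_exp_yosida_le hn s.2 _
    have h3 := h1.add (hop s (op t x))
    rw [zero_add] at h3
    refine tendsto_nhds_unique (hop (s + t) x) (h3.congr fun n => ?_)
    rw [NNReal.coe_add, exp_add_smul_apply, map_sub, sub_add_cancel]
  have hzero : op 0 = ContinuousLinearMap.id ℝ E := by
    ext x
    refine tendsto_nhds_unique (hop 0 x) (tendsto_const_nhds.congr fun n => ?_)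
    simp
  -- First order expansion at `0`, uniformly in the Yosida parameter.
  have hexp : ∀ x y, (x, y) ∈ A.graph → ∀ ε > 0, ∃ C : ℝ, 0 ≤ C ∧ ∀ t : ℝ≥0,
      ‖op t x - x - (t : ℝ) • y‖ ≤ t * ((M + 1) * ε + t * C) := by
    intro x y hxy ε hε
    obtain ⟨v, hv, hyv⟩ := Metric.mem_closure_iff.1 (hd y) ε hε
    obtain ⟨w, hw⟩ : ∃ w, (v, w) ∈ A.graph := ⟨A ⟨v, hv⟩, A.mem_graph ⟨v, hv⟩⟩
    rw [dist_eq_norm] at hyv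
    refine ⟨M * ‖w‖, by positivity, fun t => ?_⟩
    have hx := h.tendsto_yosida hM hd hxy
    have hw' := h.tendsto_yosida hM hd hw
    have hl : Tendsto (fun n : ℕ => ‖NormedSpace.exp ((t : ℝ) • yosida R n) x - x
        - (t : ℝ) • yosida R n x‖) atTop (𝓝 ‖op t x - x - (t : ℝ) • y‖) :=
      (((hop t x).sub_const x).sub (hx.const_smul (t : ℝ))).norm
    have hr : Tendsto (fun n : ℕ => ((M + 1) * ‖yosida R n x - v‖
        + t * (M * ‖yosida R n v‖)) * (t : ℝ)) atTop
        (𝓝 (((M + 1) * ‖y - v‖ + t * (M * ‖w‖)) * (t : ℝ))) :=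
      ((((hx.sub_const v).norm.const_mul _)).add ((hw'.norm.const_mul M).const_mul _)).mul_const _
    refine (le_of_tendsto_of_tendsto hl hr ?_).trans ?_
    · filter_upwards [eventually_lt ω] with n hn
      have hdv : ∀ s : ℝ, HasDerivAt (fun s : ℝ => NormedSpace.exp (s • yosida R n) x
          - s • yosida R n x)
          (NormedSpace.exp (s • yosida R n) (yosida R n x) - yosida R n x) s := fun s => by
        simpa [Pi.sub_def] using (hasDerivAt_exp_smul_apply (yosida R n) x s).sub
          ((hasDerivAt_id s).smul_const (yosida R n x))
      have hlip : ∀ s ∈ Set.Icc (0 : ℝ) t,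
          ‖NormedSpace.exp (s • yosida R n) v - v‖ ≤ M * ‖yosida R n v‖ * s := by
        intro s hs
        have := norm_image_sub_le_of_norm_deriv_le_segment' (C := M * ‖yosida R n v‖)
          (a := 0) (b := s)
          (fun r _ => (hasDerivAt_exp_smul_apply (yosida R n) v r).hasDerivWithinAt)
          (fun r hr => h.norm_exp_yosida_le hn hr.1 _) s ⟨hs.1, le_rfl⟩
        simpa using this
      have hseg := norm_image_sub_le_of_norm_deriv_le_segment'
        (C := (M + 1) * ‖yosida R n x - v‖ + t * (M * ‖yosida R n v‖)) (a := 0) (b := (t : ℝ))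
        (fun s _ => (hdv s).hasDerivWithinAt) (fun s hs => ?_) t ⟨t.2, le_rfl⟩
      · have e : NormedSpace.exp ((t : ℝ) • yosida R n) x - x - (t : ℝ) • yosida R n x
            = NormedSpace.exp ((t : ℝ) • yosida R n) x - (t : ℝ) • yosida R n x - x := by abel
        rw [e]
        simpa using hseg
      · have e : NormedSpace.exp (s • yosida R n) (yosida R n x) - yosida R n x
            = NormedSpace.exp (s • yosida R n) (yosida R n x - v) - (yosida R n x - v)
              + (NormedSpace.exp (s • yosida R n) v - v) := by rw [map_sub]; abel
        rw [e]
        have i1 := norm_add_le (NormedSpace.exp (s • yosida R n) (yosida R n x - v)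
          - (yosida R n x - v)) (NormedSpace.exp (s • yosida R n) v - v)
        have i2 := norm_sub_le (NormedSpace.exp (s • yosida R n) (yosida R n x - v))
          (yosida R n x - v)
        have i3 := h.norm_exp_yosida_le hn hs.1 (yosida R n x - v)
        have i4 := hlip s ⟨hs.1, hs.2.le⟩
        have i5 : M * ‖yosida R n v‖ * s ≤ M * ‖yosida R n v‖ * t := by gcongr; exact hs.2.le
        linarith
    · rw [mul_comm _ (t : ℝ)]
      gcongr
  have hgen : ∀ x y, (x, y) ∈ A.graph →
      Tendsto (fun t : ℝ≥0 => (t : ℝ)⁻¹ • (op t x - x)) (𝓝[>] 0) (𝓝 y) := by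
    intro x y hxy
    rw [Metric.tendsto_nhds]
    intro ε hε
    obtain ⟨C, hC, hCt⟩ := hexp x y hxy (ε / (2 * (M + 1))) (by positivity)
    have h1 : Tendsto (fun t : ℝ≥0 => (t : ℝ) * C) (𝓝[>] 0) (𝓝 0) := by
      have : Continuous fun t : ℝ≥0 => (t : ℝ) * C := by fun_prop
      simpa using (this.tendsto 0).mono_left nhdsWithin_le_nhds
    filter_upwards [h1.eventually_lt_const (half_pos hε), self_mem_nhdsWithin] with t ht ht0
    have ht0' : (0 : ℝ) < t := ht0
    have e : (t : ℝ)⁻¹ • (op t x - x) - y = (t : ℝ)⁻¹ • (op t x - x - (t : ℝ) • y) := by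
      rw [smul_sub _ (op t x - x), smul_smul, inv_mul_cancel₀ ht0'.ne', one_smul]
    rw [dist_eq_norm, e, norm_smul, norm_inv, Real.norm_of_nonneg ht0'.le]
    calc _ ≤ (t : ℝ)⁻¹ * (t * ((M + 1) * (ε / (2 * (M + 1))) + t * C)) := by gcongr; exact hCt t
      _ = ε / 2 + t * C := by field_simp
      _ < ε := by linarith
  -- Orbits of the domain are Lipschitz, and orbits of the whole space are uniform limits of them.
  have hcont : ∀ x, Continuous fun t => op t x := by
    have hclosed : IsClosed {x : E | Continuous fun t => op t x} := by
      rw [← isSeqClosed_iff_isClosed]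
      intro xs x hxs hx
      have hu : TendstoUniformly (fun (n : ℕ) (t : ℝ≥0) => op t (xs n)) (fun t => op t x)
          atTop := by
        rw [Metric.tendstoUniformly_iff]
        intro ε hε
        have : Tendsto (fun n => M * ‖x - xs n‖) atTop (𝓝 0) := by
          have := (tendsto_const_nhds (x := x)).sub hx
          simpa using this.norm.const_mul M
        filter_upwards [this.eventually_lt_const hε] with n hn t
        rw [dist_eq_norm, ← map_sub]
        exact (hopbd t _).trans_lt hn
      exact hu.continuous (Frequently.of_forall hxs)
    intro x
    refine (hd.induction (P := fun x => Continuous fun t => op t x) ?_ hclosed) x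
    intro x hx
    obtain ⟨y, hy⟩ : ∃ y, (x, y) ∈ A.graph := ⟨A ⟨x, hx⟩, A.mem_graph ⟨x, hx⟩⟩
    have hlip : LipschitzWith (Real.toNNReal (M * ‖y‖)) fun t => op t x := by
      refine LipschitzWith.of_dist_le_mul fun s t => ?_
      rw [Real.coe_toNNReal _ (by positivity)]
      wlog hst : s ≤ t generalizing s t
      · rw [dist_comm, dist_comm s]; exact this t s (le_of_not_ge hst)
      have hx' := h.tendsto_yosida hM hd hy
      have hlim : Tendsto (fun n : ℕ => ‖NormedSpace.exp ((t : ℝ) • yosida R n) x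
          - NormedSpace.exp ((s : ℝ) • yosida R n) x‖) atTop (𝓝 ‖op t x - op s x‖) :=
        ((hop t x).sub (hop s x)).norm
      have hr : Tendsto (fun n : ℕ => M * ‖yosida R n x‖ * ((t : ℝ) - s)) atTop
          (𝓝 (M * ‖y‖ * ((t : ℝ) - s))) := (hx'.norm.const_mul M).mul_const _
      rw [dist_comm, dist_eq_norm, NNReal.dist_eq, abs_sub_comm,
        abs_of_nonneg (sub_nonneg.2 (NNReal.coe_le_coe.2 hst))]
      refine le_of_tendsto_of_tendsto hlim hr ?_
      filter_upwards [eventually_lt ω] with n hn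
      exact norm_image_sub_le_of_norm_deriv_le_segment'
        (fun r _ => (hasDerivAt_exp_smul_apply (yosida R n) x r).hasDerivWithinAt)
        (fun r hr => h.norm_exp_yosida_le hn (s.2.trans hr.1) _) t ⟨NNReal.coe_le_coe.2 hst, le_rfl⟩
    exact hlip.continuous
  refine ⟨⟨op, hzero, hadd, hcont⟩, fun x y => ⟨hgen x y, fun hxy => ?_⟩, hop⟩
  -- The resolvent commutes with the semigroup, so that `R l` maps the difference quotients at `x`
  -- to those at `R l x`; this puts `x` into the range of `R l`.
  have hl : ω < ω + 1 := lt_add_one ω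
  set l := ω + 1
  have hcomm : ∀ t v, R l (op t v) = op t (R l v) := by
    intro t v
    refine tendsto_nhds_unique (((R l).continuous.tendsto _).comp (hop t v))
      ((hop t (R l v)).congr' ?_)
    filter_upwards [eventually_lt ω] with n hn
    let _ : NormedAlgebra ℚ (E →L[ℝ] E) := NormedAlgebra.restrictScalars ℚ ℝ _
    have h3 : Commute (R l) (NormedSpace.exp ((t : ℝ) • yosida R n)) :=
      ((h.commute_yosida hl hn).smul_right _).exp_right
    exact (congrArg (fun T : E →L[ℝ] E => T v) h3.eq).symm
  have h1 := ((R l).continuous.tendsto _).comp hxy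
  have h2 := hgen _ _ (h.right_inv l hl x)
  have h3 : R l y = l • R l x - x := by
    refine tendsto_nhds_unique h1 (h2.congr fun t => ?_)
    simp only [Function.comp_apply, map_smul, map_sub, hcomm]
  have h4 : R l (l • x - y) = x := by rw [map_sub, map_smul, h3]; abel
  have h5 := h.right_inv l hl (l • x - y)
  rw [h4] at h5
  simpa using h5

end IsBoundedResolvent

/-- Exponential bounds on the powers of the resolvent at a vector are inherited by its orbit. -/
theorem norm_le_of_tendsto_exp_yosida [CompleteSpace E] {ω : ℝ} {R : ℝ → E →L[ℝ] E}
    {x y : E} {t C r : ℝ} (ht : 0 ≤ t) (hr : 0 ≤ r)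
    (hy : Tendsto (fun n : ℕ => NormedSpace.exp (t • yosida R n) x) atTop (𝓝 y))
    (hx : ∀ l, ω < l → ∀ k : ℕ, ‖(R l ^ k) x‖ ≤ C * ((l + r)⁻¹) ^ k) :
    ‖y‖ ≤ C * Real.exp (-r * t) := by
  have h1 : Tendsto (fun n : ℕ => t * ((n : ℝ) ^ 2 * ((n : ℝ) + r)⁻¹ - n)) atTop
      (𝓝 (-r * t)) := by
    have h2 : Tendsto (fun n : ℕ => (n : ℝ) / (n + r)) atTop (𝓝 1) :=
      tendsto_natCast_div_add_atTop r
    refine (h2.const_mul (-r * t)).congr' ?_ |>.trans (by simp)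
    filter_upwards [IsBoundedResolvent.eventually_lt 0] with n hn
    field_simp
    ring
  refine le_of_tendsto_of_tendsto hy.norm
    (((Real.continuous_exp.tendsto _).comp h1).const_mul C) ?_
  filter_upwards [IsBoundedResolvent.eventually_lt ω] with n hn
  exact norm_exp_yosida_apply_le R x (hx n hn) ht

end HilleYosida

/-! ### Enlargement of the space at the level of resolvents -/

section Enlargement

variable {E H : Type*} [NormedAddCommGroup E] [NormedSpace ℝ E] [NormedAddCommGroup H]
  [NormedSpace ℝ H]

/-- Extension of a resolvent bound from the small space `H` to the large space `E`. Here `R` is the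
resolvent of `Λ` at `l`, `RB` that of `Λ - ι A` with `A : E → H` bounded, `m` a conserved functional
and `e` the equilibrium. A vector with `m = 0` is split into a part in `E` that evolves by `RB` and
a part in `H` that evolves by `R` and is fed by the first; the cost `K ‖x‖ + ‖y‖` of the splitting
decays at the rate of `R` on `H` as soon as `K` is large enough. -/
theorem exists_splitting {ι : H →L[ℝ] E} {A : E →L[ℝ] H} {m : E →L[ℝ] ℝ} {eH : H}
    (he : m (ι eH) = 1) {R RB : E →L[ℝ] E} {l μ l₀ r K : ℝ} (hl : 0 < l) (hr : 0 ≤ r)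
    (hK : 0 < K) (hrl : r ≤ l₀) (hμ : 0 < μ)
    (hRe : R (ι eH) = l⁻¹ • ι eH)
    (hRB : ∀ x, ‖RB x‖ ≤ ‖x‖ / (l + μ))
    (hdec : ∀ x, R x = RB x + R (ι (A (RB x))))
    (hH : ∀ y, m (ι y) = 0 → ∃ y', ι y' = R (ι y) ∧ ‖y'‖ ≤ ‖y‖ / (l + l₀))
    (hcons : ∀ x, m (R x) = l⁻¹ * m x)
    (hKA : K * r + ‖A‖ * (1 + ‖m‖ * ‖ι‖ * ‖eH‖) ≤ K * μ) (g : E) (k : ℕ) :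
    ∃ (x : E) (y : H) (c : ℝ), (R ^ k) g = x + ι y + c • ι eH ∧ m (ι y) = 0 ∧
      K * ‖x‖ + ‖y‖ ≤ K * ‖g‖ * ((l + r)⁻¹) ^ k := by
  induction k with
  | zero => exact ⟨g, 0, 0, by simp, by simp, by simp⟩
  | succ k ih =>
    obtain ⟨x, y, c, hx, hy, hxy⟩ := ih
    set v := A (RB x) with hv
    set P := v - m (ι v) • eH with hP
    have hmP : m (ι (y + P)) = 0 := by simp [hP, hy, he]
    obtain ⟨y', hy', hy'n⟩ := hH _ hmP
    refine ⟨RB x, y', l⁻¹ * (m (ι v) + c), ?_, ?_, ?_⟩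
    · rw [pow_succ', mul_apply_eq_comp, hx, map_add, map_add, hdec x, hy', map_smul, hRe,
        ← hv]
      have : ι v = ι P + m (ι v) • ι eH := by simp [hP]
      rw [this, map_add ι, map_add R, map_add R, map_smul, hRe, ← this]
      module
    · rw [hy', hcons, hmP, mul_zero]
    · have h1 : ‖v‖ ≤ ‖A‖ * (‖x‖ / (l + μ)) :=
        (A.le_opNorm _).trans (by gcongr; exact hRB x)
      have h2 : ‖P‖ ≤ ‖v‖ * (1 + ‖m‖ * ‖ι‖ * ‖eH‖) := by
        have h3 : ‖m (ι v)‖ ≤ ‖m‖ * (‖ι‖ * ‖v‖) :=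
          (m.le_opNorm _).trans (by gcongr; exact ι.le_opNorm _)
        calc ‖P‖ ≤ ‖v‖ + ‖m (ι v)‖ * ‖eH‖ := by rw [← norm_smul]; exact norm_sub_le _ _
          _ ≤ ‖v‖ + ‖m‖ * (‖ι‖ * ‖v‖) * ‖eH‖ := by gcongr
          _ = _ := by ring
      set Z := 1 + ‖m‖ * ‖ι‖ * ‖eH‖ with hZ
      have hZ0 : 0 ≤ Z := by positivity
      have h4 : ‖y'‖ ≤ (‖y‖ + ‖A‖ * (‖x‖ / (l + μ)) * Z) / (l + r) := by
        refine hy'n.trans ?_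
        calc _ ≤ ‖y + P‖ / (l + r) := by gcongr
          _ ≤ _ := by
            gcongr
            refine (norm_add_le _ _).trans ?_
            gcongr
            exact h2.trans (by gcongr)
      have h5 : K * ‖RB x‖ ≤ K * (‖x‖ / (l + μ)) := by gcongr; exact hRB x
      have h6 : K * (‖x‖ / (l + μ)) + (‖y‖ + ‖A‖ * (‖x‖ / (l + μ)) * Z) / (l + r)
          ≤ (K * ‖x‖ + ‖y‖) / (l + r) := by
        have h7 : K * (‖x‖ / (l + μ)) = (K * (l + r)) * (‖x‖ / (l + μ)) / (l + r) := by
          field_simp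
        rw [h7, ← add_div]
        refine div_le_div_of_nonneg_right ?_ (by positivity)
        have h8 : (K * (l + r) + ‖A‖ * Z) * (‖x‖ / (l + μ)) ≤ K * (l + μ) * (‖x‖ / (l + μ)) := by
          gcongr
          linarith
        have h9 : K * (l + μ) * (‖x‖ / (l + μ)) = K * ‖x‖ := by field_simp
        linarith
      calc K * ‖RB x‖ + ‖y'‖ ≤ (K * ‖x‖ + ‖y‖) / (l + r) := by linarith
        _ ≤ (K * ‖g‖ * ((l + r)⁻¹) ^ k) / (l + r) := by gcongr
        _ = _ := by rw [pow_succ, div_eq_mul_inv]; ring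

/-- Under the hypotheses of `exists_splitting`, which hold for all `l > ω` with the same `A`, the
powers of the resolvent decay at rate `r` on the kernel of `m`. -/
theorem exists_norm_resolvent_pow_le {ι : H →L[ℝ] E} {A : E →L[ℝ] H} {m : E →L[ℝ] ℝ} {eH : H}
    (he : m (ι eH) = 1) {R RB : ℝ → E →L[ℝ] E} {ω μ l₀ r : ℝ} (hω : 0 ≤ ω) (hr : 0 ≤ r)
    (hrl : r ≤ l₀) (hrμ : r < μ)
    (hRe : ∀ l, ω < l → R l (ι eH) = l⁻¹ • ι eH)
    (hRB : ∀ l, ω < l → ∀ x, ‖RB l x‖ ≤ ‖x‖ / (l + μ))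
    (hdec : ∀ l, ω < l → ∀ x, R l x = RB l x + R l (ι (A (RB l x))))
    (hH : ∀ l, ω < l → ∀ y, m (ι y) = 0 → ∃ y', ι y' = R l (ι y) ∧ ‖y'‖ ≤ ‖y‖ / (l + l₀))
    (hcons : ∀ l, ω < l → ∀ x, m (R l x) = l⁻¹ * m x) :
    ∃ C : ℝ, 0 < C ∧ ∀ g, m g = 0 → ∀ l, ω < l → ∀ k : ℕ,
      ‖(R l ^ k) g‖ ≤ C * ‖g‖ * ((l + r)⁻¹) ^ k := by
  set Z := ‖A‖ * (1 + ‖m‖ * ‖ι‖ * ‖eH‖) with hZ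
  have hZ0 : 0 ≤ Z := by positivity
  set K := (Z + 1) / (μ - r) with hKdef
  have hμr : 0 < μ - r := sub_pos.2 hrμ
  have hK : 0 < K := by positivity
  have hKA : K * r + Z ≤ K * μ := by
    have : K * (μ - r) = Z + 1 := by rw [hKdef]; field_simp
    linarith
  set q := 1 + ‖m‖ * ‖ι eH‖ with hq
  have hq0 : 0 < q := by positivity
  refine ⟨(q / K + ‖ι‖) * K, by positivity, fun g hg l hl k => ?_⟩
  have hl0 : 0 < l := hω.trans_lt hl
  obtain ⟨x, y, c, hx, hy, hxy⟩ := exists_splitting he hl0 hr hK hrl (hr.trans_lt hrμ) (hRe l hl)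
    (hRB l hl) (hdec l hl) (hH l hl) (hcons l hl) hKA g k
  have hm : m ((R l ^ k) g) = 0 := by
    clear hx hxy
    induction k with
    | zero => simpa using hg
    | succ k ih => rw [pow_succ', mul_apply_eq_comp, hcons l hl, ih, mul_zero]
  have hc : c = -m x := by
    rw [hx, map_add, map_add, map_smul, hy, he, smul_eq_mul] at hm
    linarith
  have h1 : ‖x + c • ι eH‖ ≤ q * ‖x‖ := by
    refine (norm_add_le _ _).trans ?_
    rw [norm_smul, hc, norm_neg]
    have := m.le_opNorm x
    calc ‖x‖ + ‖m x‖ * ‖ι eH‖ ≤ ‖x‖ + ‖m‖ * ‖x‖ * ‖ι eH‖ := by gcongr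
      _ = q * ‖x‖ := by rw [hq]; ring
  calc ‖(R l ^ k) g‖ = ‖(x + c • ι eH) + ι y‖ := by rw [hx]; congr 1; abel
    _ ≤ q * ‖x‖ + ‖ι‖ * ‖y‖ := (norm_add_le _ _).trans (add_le_add h1 (ι.le_opNorm y))
    _ ≤ (q / K + ‖ι‖) * (K * ‖x‖ + ‖y‖) := by
        have e : (q / K + ‖ι‖) * (K * ‖x‖ + ‖y‖)
          = q * ‖x‖ + ‖ι‖ * ‖y‖ + (q / K * ‖y‖ + ‖ι‖ * (K * ‖x‖)) := by
          field_simp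
          ring
        rw [e]
        exact le_add_of_nonneg_right (by positivity)
    _ ≤ (q / K + ‖ι‖) * (K * ‖g‖ * ((l + r)⁻¹) ^ k) := by gcongr
    _ = _ := by ring

end Enlargement

section Galerkin

variable {E : Type*} [NormedAddCommGroup E] [NormedSpace ℝ E]

/-- Neumann series: `1 - K` is invertible for `‖K‖ < 1`. -/
theorem exists_inverse_one_sub [CompleteSpace E] {K : E →L[ℝ] E} (hK : ‖K‖ < 1) :
    ∃ U : E →L[ℝ] E, (∀ x, U x - K (U x) = x) ∧ ∀ x, U (x - K x) = x := by
  refine ⟨↑(Units.oneSub K hK)⁻¹, fun x => ?_, fun x => ?_⟩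
  · have := congrArg (fun T : E →L[ℝ] E => T x) (Units.oneSub K hK).mul_inv
    simpa using this
  · have := congrArg (fun T : E →L[ℝ] E => T x) (Units.oneSub K hK).inv_mul
    simpa using this

/-- Convergence of the Galerkin approximations: if `P n → 1` strongly, then the solution of
`u n = P n K P n (u n) + P n x` converges to that of `u = K u + x`. -/
theorem exists_tendsto_galerkin [CompleteSpace E] {K : E →L[ℝ] E} (hK : ‖K‖ < 1)
    {P : ℕ → E →L[ℝ] E} (hP : ∀ n x, ‖P n x‖ ≤ ‖x‖)
    (hlim : ∀ x, Tendsto (fun n => P n x) atTop (𝓝 x)) {x u : E} (hu : u - K u = x) :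
    ∃ v : ℕ → E, (∀ n, v n - P n (K (P n (v n))) = P n x) ∧ Tendsto v atTop (𝓝 u) := by
  have hPn : ∀ n, ‖P n‖ ≤ 1 := fun n =>
    (P n).opNorm_le_bound zero_le_one fun x => by simpa using hP n x
  have hKP : ∀ n, ‖(P n).comp (K.comp (P n))‖ ≤ ‖K‖ := fun n => by
    calc _ ≤ ‖P n‖ * (‖K‖ * ‖P n‖) := (ContinuousLinearMap.opNorm_comp_le _ _).trans
          (by gcongr; exact ContinuousLinearMap.opNorm_comp_le _ _)
      _ ≤ 1 * (‖K‖ * 1) := by gcongr <;> exact hPn n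
      _ = ‖K‖ := by ring
  choose U hU _ using fun n => exists_inverse_one_sub ((hKP n).trans_lt hK)
  refine ⟨fun n => U n (P n x), fun n => hU n _, ?_⟩
  have hKPu : Tendsto (fun n => P n (K (P n u))) atTop (𝓝 (K u)) := by
    have h1 : Tendsto (fun n => ‖K (P n u - u)‖) atTop (𝓝 0) := by
      have := ((K.continuous.tendsto _).comp ((hlim u).sub_const u)).norm
      simpa [Function.comp_def] using this
    have h2 : Tendsto (fun n => P n (K (P n u - u))) atTop (𝓝 0) :=
      squeeze_zero_norm (fun n => hP n _) h1
    have h3 := h2.add (hlim (K u))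
    rw [zero_add] at h3
    refine h3.congr fun n => ?_
    rw [map_sub, map_sub, sub_add_cancel]
  have hres : Tendsto (fun n => P n x - (u - P n (K (P n u)))) atTop (𝓝 0) := by
    have := (hlim x).sub ((tendsto_const_nhds (x := u)).sub hKPu)
    rwa [hu, sub_self] at this
  have hpos : 0 < 1 - ‖K‖ := sub_pos.2 hK
  rw [tendsto_iff_norm_sub_tendsto_zero]
  have h0 : Tendsto (fun n => ‖P n x - (u - P n (K (P n u)))‖ / (1 - ‖K‖)) atTop (𝓝 0) := by
    simpa using hres.norm.div_const (1 - ‖K‖)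
  refine squeeze_zero (fun n => norm_nonneg _) (fun n => ?_) h0
  rw [le_div_iff₀ hpos]
  set d := U n (P n x) - u with hd
  have h1 : d = P n (K (P n d)) + (P n x - (u - P n (K (P n u)))) := by
    have := hU n (P n x)
    simp only [ContinuousLinearMap.comp_apply] at this
    rw [hd]
    generalize U n (P n x) = v at this
    rw [← this]
    simp only [map_sub]
    abel
  have h2 : ‖P n (K (P n d))‖ ≤ ‖K‖ * ‖d‖ :=
    ((hP n _).trans (K.le_opNorm _)).trans (by gcongr; exact hP n _)
  have h3 : ‖d‖ ≤ ‖K‖ * ‖d‖ + ‖P n x - (u - P n (K (P n u)))‖ := by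
    calc ‖d‖ = _ := congrArg norm h1
      _ ≤ _ := (norm_add_le _ _).trans (by gcongr)
  linarith

end Galerkin

/-! ### Coefficients and summability -/

namespace PNat

theorem summable_iff_shift {f : ℕ+ → ℝ} : Summable (fun i => f (i + 1)) ↔ Summable f := by
  rw [← (Equiv.pnatEquivNat.symm).summable_iff,
    ← (Equiv.pnatEquivNat.symm).summable_iff (f := f),
    ← summable_nat_add_iff (f := f ∘ Equiv.pnatEquivNat.symm) 1]
  rfl

theorem tsum_eq_add_shift {f : ℕ+ → ℝ} (hf : Summable f) :
    ∑' i, f i = f 1 + ∑' i, f (i + 1) := by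
  rw [← (Equiv.pnatEquivNat.symm).tsum_eq f,
    ← (Equiv.pnatEquivNat.symm).tsum_eq fun i => f (i + 1),
    Summable.tsum_eq_zero_add (f := fun n => f (Equiv.pnatEquivNat.symm n))
      ((Equiv.pnatEquivNat.symm).summable_iff.2 hf)]
  rfl

theorem tsum_shift_le {f : ℕ+ → ℝ} (hf : Summable f) (h0 : ∀ i, 0 ≤ f i) :
    ∑' i, f (i + 1) ≤ ∑' i, f i := by
  rw [tsum_eq_add_shift hf]
  linarith [h0 1]

theorem eq_one_or_exists_succ (i : ℕ+) : i = 1 ∨ ∃ j, i = j + 1 := by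
  rcases eq_or_ne i 1 with h | h
  · exact Or.inl h
  · exact Or.inr ((PNat.exists_eq_succ_of_ne_one h).imp fun _ h => h)

theorem eventually_of_eventually_shift {p : ℕ+ → Prop} (h : ∀ᶠ i in atTop, p (i + 1)) :
    ∀ᶠ i in atTop, p i := by
  obtain ⟨N, hN⟩ := eventually_atTop.1 h
  refine eventually_atTop.2 ⟨N + 1, fun i hi => ?_⟩
  rcases eq_one_or_exists_succ i with rfl | ⟨j, rfl⟩
  · exact absurd hi (not_le.2 (PNat.lt_add_left 1 N))
  · exact hN j ((add_le_add_iff_right 1).1 hi)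

theorem summable_of_eventually_ratio_le {f : ℕ+ → ℝ} {θ : ℝ} (hθ : θ < 1) (h0 : ∀ i, 0 ≤ f i)
    (h : ∀ᶠ i in atTop, f (i + 1) ≤ θ * f i) : Summable f := by
  rw [← (Equiv.pnatEquivNat.symm).summable_iff]
  refine summable_of_ratio_norm_eventually_le hθ ?_
  obtain ⟨N, hN⟩ := eventually_atTop.1 h
  refine eventually_atTop.2 ⟨N, fun n hn => ?_⟩
  have := hN n.succPNat (by rw [← PNat.coe_le_coe]; simpa using hn.trans n.le_succ)
  simp only [Function.comp_apply, Real.norm_of_nonneg (h0 _)]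
  exact this

theorem one_le_cast (i : ℕ+) : (1 : ℝ) ≤ i := by exact_mod_cast (one_le : 1 ≤ i)

end PNat

namespace BeckerDoring

variable (S : BeckerDoring)

theorem Qz_pos (i : ℕ+) : 0 < S.Qz i := mul_pos (S.Q_pos i) (pow_pos S.z_pos _)

theorem Q_succ (i : ℕ+) : S.Q (i + 1) = S.a i / S.b (i + 1) * S.Q i := by simp [Q]

theorem b_succ_pos (i : ℕ+) : 0 < S.b (i + 1) := S.b_pos _ (PNat.lt_add_left 1 i)

theorem b_nonneg (i : ℕ+) : 0 ≤ S.b i := by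
  rcases PNat.eq_one_or_exists_succ i with rfl | ⟨j, rfl⟩
  · exact S.b_one.ge
  · exact (S.b_succ_pos j).le

theorem Qz_one : S.Qz 1 = S.z := by simp [Qz, Q]

/-- Detailed balance. -/
theorem b_succ_mul_Qz_succ (i : ℕ+) : S.b (i + 1) * S.Qz (i + 1) = S.a i * S.z * S.Qz i := by
  have := (S.b_succ_pos i).ne'
  rw [Qz, Qz, Q_succ, PNat.add_coe, PNat.one_coe, pow_succ]
  field_simp

theorem weight_one (η : ℝ) : S.weight η 1 = Real.exp η * S.z := by
  simp [weight, Qz_one]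

theorem weight_succ_mul_b_succ (η : ℝ) (i : ℕ+) :
    S.weight η (i + 1) * S.b (i + 1) = Real.exp η * (S.a i * S.z) * S.weight η i := by
  have h := S.b_succ_mul_Qz_succ i
  have e : Real.exp (η * ((i + 1 : ℕ+) : ℝ)) = Real.exp (η * i) * Real.exp η := by
    rw [← Real.exp_add]; push_cast; ring_nf
  rw [weight, weight, e]
  linear_combination (Real.exp (η * i) * Real.exp η) * h

theorem Qz_eq_weight (η : ℝ) (i : ℕ+) : S.Qz i = Real.exp (-(η * i)) * S.weight η i := by
  rw [weight, ← mul_assoc, ← Real.exp_add]; simp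

theorem L_one (h : ℕ+ → ℝ) : S.L h 1 = -(1 / S.z) * (S.W h 1 + ∑' k, S.W h k) := by
  simp [L, Qz_one]

theorem Qz_mul_L_succ (h : ℕ+ → ℝ) (j : ℕ+) :
    S.Qz (j + 1) * S.L h (j + 1) = S.W h j - S.W h (j + 1) := by
  have h1 : j + 1 ≠ 1 := (PNat.lt_add_left 1 j).ne'
  have h2 := (S.Qz_pos (j + 1)).ne'
  rw [L, if_neg h1, PNat.add_sub]
  field_simp

theorem W_eq (h : ℕ+ → ℝ) (k : ℕ+) :
    S.W h k = S.a k * S.z * S.Qz k * (h k + h 1 - h (k + 1)) := by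
  rw [W, Qz_one]; ring

theorem L_succ (h : ℕ+ → ℝ) (j : ℕ+) :
    S.L h (j + 1) = S.b (j + 1) * (h j + h 1 - h (j + 1))
      - S.a (j + 1) * S.z * (h (j + 1) + h 1 - h (j + 1 + 1)) := by
  have h2 := (S.Qz_pos (j + 1)).ne'
  have h3 := S.Qz_mul_L_succ h j
  rw [W_eq, W_eq, ← b_succ_mul_Qz_succ] at h3
  apply mul_left_cancel₀ h2
  linear_combination h3

/-- The consequences of the hypotheses on the coefficients on which everything below rests: the
fragmentation rates exceed the coagulation rates by the factor `e ^ (2 η)` for large clusters, and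
the equilibrium has the moments that are needed. -/
structure Subcritical (η : ℝ) : Prop where
  eta_pos : 0 < η
  exists_le_a : ∃ c, 0 < c ∧ ∀ i, c ≤ S.a i
  frag : ∀ᶠ i in atTop, Real.exp (2 * η) * (S.a i * S.z) ≤ S.b i
  ratio : ∃ θ, 0 < θ ∧ θ < 1 ∧ ∀ᶠ i in atTop, S.Qz (i + 1) ≤ θ * S.Qz i
  summable_exp : Summable fun i : ℕ+ => Real.exp (2 * η * i) * S.Qz i
  summable_sq : Summable fun i : ℕ+ => (i : ℝ) ^ 2 * (1 + S.a i + S.b i) ^ 2 * S.Qz i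

theorem ofReal_exp_lt_of_lt_half_log {η : ℝ} {r : ℝ≥0∞}
    (h : (η : EReal) < ((1 / 2 : ℝ) : EReal) * ENNReal.log r) :
    ENNReal.ofReal (Real.exp (2 * η)) < r := by
  have h1 : ((2 * η : ℝ) : EReal) < ENNReal.log r := by
    induction hl : ENNReal.log r with
    | bot => rw [hl, EReal.coe_mul_bot_of_pos (by norm_num)] at h; exact absurd h not_lt_bot
    | top => exact EReal.coe_lt_top _
    | coe x =>
      rw [hl, ← EReal.coe_mul, EReal.coe_lt_coe_iff] at h
      rw [EReal.coe_lt_coe_iff]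
      linarith
  have h2 := EReal.exp_lt_exp_iff.2 h1
  rwa [ENNReal.exp_log, EReal.exp_coe] at h2

/-- Below the critical density, and below the critical exponent, `e ^ (2 η) z Q_{i+1} / Q_i` stays
eventually below some `θ < 1`, also when `z_s = ∞`. -/
theorem exists_ratio_bound {η : ℝ}
    (hQ : Tendsto (fun i : ℕ+ => ENNReal.ofReal (S.Q (i + 1) / S.Q i)) atTop (𝓝 S.zs⁻¹))
    (hη' : (η : EReal) < ((1 / 2 : ℝ) : EReal) * ENNReal.log (S.zs / ENNReal.ofReal S.z)) :
    ∃ θ, 0 < θ ∧ θ < 1 ∧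
      ∀ᶠ i in atTop, Real.exp (2 * η) * S.z * S.Q (i + 1) ≤ θ * S.Q i := by
  have h1 := ofReal_exp_lt_of_lt_half_log hη'
  have hz := S.z_pos
  set d := Real.exp (2 * η) * S.z with hd
  have hd0 : 0 < d := by positivity
  have h2 : ENNReal.ofReal d < S.zs := by
    rw [hd, ENNReal.ofReal_mul (Real.exp_pos _).le]
    exact ENNReal.mul_lt_of_lt_div h1
  have h3 : S.zs⁻¹ < ENNReal.ofReal d⁻¹ := by
    rw [ENNReal.ofReal_inv_of_pos hd0]
    exact ENNReal.inv_lt_inv.2 h2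
  obtain ⟨c, hc0, hc1, hc2⟩ := ENNReal.lt_iff_exists_real_btwn.1 h3
  have hc : 0 < c := ENNReal.ofReal_pos.1 (bot_le.trans_lt hc1)
  have hc2' : c < d⁻¹ := (ENNReal.ofReal_lt_ofReal_iff (by positivity)).1 hc2
  refine ⟨d * c, by positivity, ?_, ?_⟩
  · calc d * c < d * d⁻¹ := by gcongr
      _ = 1 := mul_inv_cancel₀ hd0.ne'
  · filter_upwards [hQ.eventually_lt_const hc1] with i hi
    have h4 := (ENNReal.ofReal_lt_ofReal_iff hc).1 hi
    rw [div_lt_iff₀ (S.Q_pos i)] at h4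
    rw [mul_assoc d]
    exact mul_le_mul_of_nonneg_left h4.le hd0.le

theorem subcritical
    (hA : Summable fun i : ℕ+ => (i : ℝ) ^ 2 * (1 + S.a i + S.b i) ^ 2 * S.Qz i)
    (ha_inf : 0 < ⨅ i, S.a i)
    (hQ : Tendsto (fun i : ℕ+ => ENNReal.ofReal (S.Q (i + 1) / S.Q i)) atTop (𝓝 S.zs⁻¹))
    (ha_lim : Tendsto (fun i : ℕ+ => S.a (i + 1) / S.a i) atTop (𝓝 1))
    {η : ℝ} (hη : 0 < η)
    (hη' : (η : EReal) < ((1 / 2 : ℝ) : EReal) * ENNReal.log (S.zs / ENNReal.ofReal S.z)) :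
    S.Subcritical η := by
  obtain ⟨θ, hθ0, hθ1, hθ⟩ := S.exists_ratio_bound hQ hη'
  have hz := S.z_pos
  have hratio : ∀ᶠ i in atTop, Real.exp (2 * η) * S.Qz (i + 1) ≤ θ * S.Qz i := by
    filter_upwards [hθ] with i hi
    have : 0 < S.z ^ (i : ℕ) := by positivity
    calc Real.exp (2 * η) * S.Qz (i + 1)
        = Real.exp (2 * η) * S.z * S.Q (i + 1) * S.z ^ (i : ℕ) := by
          rw [Qz, PNat.add_coe, PNat.one_coe, pow_succ]; ring
      _ ≤ θ * S.Q i * S.z ^ (i : ℕ) := by gcongr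
      _ = θ * S.Qz i := by rw [Qz]; ring
  refine ⟨hη, ⟨_, ha_inf, fun i => ciInf_le ⟨0, ?_⟩ i⟩, ?_, ⟨θ, hθ0, hθ1, ?_⟩, ?_, hA⟩
  · rintro _ ⟨j, rfl⟩
    exact (S.a_pos j).le
  · refine PNat.eventually_of_eventually_shift ?_
    -- The margin `θ < 1` absorbs the ratio `a (i + 1) / a i`, which tends to `1`.
    have h1 : (1 : ℝ) < θ⁻¹ := (one_lt_inv₀ hθ0).2 hθ1
    filter_upwards [hθ, ha_lim.eventually_lt_const h1] with i hi hai
    have ha := S.a_pos i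
    have hQi := S.Q_pos (i + 1)
    rw [div_lt_iff₀ ha, inv_mul_eq_div, lt_div_iff₀ hθ0] at hai
    have hb : S.b (i + 1) * S.Q (i + 1) = S.a i * S.Q i := by
      have := (S.b_succ_pos i).ne'
      rw [Q_succ]; field_simp
    refine le_of_mul_le_mul_right ?_ (mul_pos hQi hθ0)
    calc Real.exp (2 * η) * (S.a (i + 1) * S.z) * (S.Q (i + 1) * θ)
        = (S.a (i + 1) * θ) * (Real.exp (2 * η) * S.z * S.Q (i + 1)) := by ring
      _ ≤ S.a i * (θ * S.Q i) := by gcongr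
      _ = S.b (i + 1) * (S.Q (i + 1) * θ) := by rw [← mul_assoc (S.b _), hb]; ring
  · filter_upwards [hratio] with i hi
    have h1 : 1 ≤ Real.exp (2 * η) := Real.one_le_exp (by positivity)
    exact (le_mul_of_one_le_left (S.Qz_pos _).le h1).trans hi
  · refine PNat.summable_of_eventually_ratio_le hθ1
      (fun i => mul_nonneg (Real.exp_pos _).le (S.Qz_pos i).le) ?_
    filter_upwards [hratio] with i hi
    have e : Real.exp (2 * η * ((i + 1 : ℕ+) : ℝ)) = Real.exp (2 * η * i) * Real.exp (2 * η) := by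
      rw [← Real.exp_add]; push_cast; ring_nf
    calc _ = Real.exp (2 * η * i) * (Real.exp (2 * η) * S.Qz (i + 1)) := by rw [e]; ring
      _ ≤ Real.exp (2 * η * i) * (θ * S.Qz i) := by gcongr
      _ = _ := by ring

namespace Subcritical

variable {S} {η : ℝ}

/-- Everything polynomial in the index and linear in the rates is summable against the weights, by
`e ^ (η i) x ≤ e ^ (2 η i) + x ^ 2`. -/
theorem summable_weight (hS : S.Subcritical η) :
    Summable fun i : ℕ+ => S.weight η i * ((i : ℝ) * (1 + S.a i + S.b i)) := by
  refine Summable.of_nonneg_of_le (fun i => ?_) (fun i => ?_) (hS.summable_exp.add hS.summable_sq)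
  · have := S.weight_pos η i
    have := S.a_pos i
    have := S.b_nonneg i
    positivity
  · have hQ := S.Qz_pos i
    have e : Real.exp (2 * η * i) = Real.exp (η * i) ^ 2 := by
      rw [← Real.exp_nat_mul]; push_cast; ring_nf
    set x := Real.exp (η * i)
    set y := (i : ℝ) * (1 + S.a i + S.b i) with hy
    have h1 : x * y ≤ x ^ 2 + y ^ 2 := by nlinarith [sq_nonneg (x - y), sq_nonneg (x + y)]
    calc S.weight η i * y = (x * y) * S.Qz i := by rw [weight]; ring
      _ ≤ (x ^ 2 + y ^ 2) * S.Qz i := by gcongr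
      _ = _ := by rw [e, hy]; ring

theorem summable_weight_of_abs_le (hS : S.Subcritical η) {f : ℕ+ → ℝ} {C : ℝ}
    (hf : ∀ i, |f i| ≤ C * ((i : ℝ) * (1 + S.a i + S.b i))) :
    Summable fun i => S.weight η i * f i := by
  refine Summable.of_norm_bounded (hS.summable_weight.mul_left C) fun i => ?_
  rw [Real.norm_eq_abs, abs_mul, abs_of_pos (S.weight_pos η i), mul_left_comm]
  gcongr
  · exact (S.weight_pos η i).le
  · exact hf i

end Subcritical

end BeckerDoring

/-! ### Column sums of the operator -/

namespace BeckerDoring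

variable (S : BeckerDoring)

theorem sigma_succ (j : ℕ+) : S.sigma (j + 1) = S.a (j + 1) * S.z + S.b (j + 1) := by
  rw [sigma, if_neg (PNat.lt_add_left 1 j).ne', Qz_one]

theorem le_sigma (i : ℕ+) : S.a i * S.z + S.b i ≤ S.sigma i := by
  rcases PNat.eq_one_or_exists_succ i with rfl | ⟨j, rfl⟩
  · have h1 : 0 ≤ ∑' k, S.a k * S.Qz k :=
      tsum_nonneg fun k => mul_nonneg (S.a_pos k).le (S.Qz_pos k).le
    have h2 := mul_pos (S.a_pos 1) S.z_pos
    rw [sigma, if_pos rfl, S.b_one, Qz_one]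
    linarith
  · rw [sigma_succ]

theorem rate_pos (i : ℕ+) : 0 < S.a i * S.z + S.b i :=
  add_pos_of_pos_of_nonneg (mul_pos (S.a_pos i) S.z_pos) (S.b_nonneg i)

theorem sigma_pos (i : ℕ+) : 0 < S.sigma i := (S.rate_pos i).trans_le (S.le_sigma i)

theorem exists_sigma_le : ∃ C, 0 < C ∧ ∀ i, 1 + S.sigma i ≤ C * (1 + S.a i + S.b i) := by
  have hz := S.z_pos
  refine ⟨1 + S.z + S.sigma 1, by linarith [S.sigma_pos 1], fun i => ?_⟩
  have ha := S.a_pos i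
  have hb := S.b_nonneg i
  have h1 := S.sigma_pos 1
  rcases PNat.eq_one_or_exists_succ i with rfl | ⟨j, rfl⟩
  · nlinarith [mul_nonneg h1.le ha.le, mul_nonneg h1.le hb]
  · rw [sigma_succ]
    nlinarith [mul_nonneg h1.le ha.le, mul_nonneg h1.le hb, mul_nonneg hz.le hb]

/-- Membership in `X₁` for a bare sequence. -/
def InX1 (η : ℝ) (h : ℕ+ → ℝ) : Prop :=
  Summable fun i => (1 + S.sigma i) * (S.weight η i * |h i|)

variable {S} {η : ℝ} {h : ℕ+ → ℝ}

theorem InX1.summable_weight (hh : S.InX1 η h) : Summable fun i => S.weight η i * |h i| := by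
  refine Summable.of_nonneg_of_le (fun i => ?_) (fun i => ?_) hh
  · exact mul_nonneg (S.weight_pos η i).le (abs_nonneg _)
  · refine le_mul_of_one_le_left (mul_nonneg (S.weight_pos η i).le (abs_nonneg _)) ?_
    linarith [S.sigma_pos i]

theorem InX1.summable_mul_of_abs_le (hh : S.InX1 η h) {c : ℕ+ → ℝ} {C : ℝ}
    (hc : ∀ i, |c i| ≤ C * (1 + S.sigma i)) :
    Summable fun i => c i * (S.weight η i * |h i|) := by
  refine Summable.of_norm_bounded (hh.mul_left C) fun i => ?_
  have : 0 ≤ S.weight η i * |h i| := mul_nonneg (S.weight_pos η i).le (abs_nonneg _)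
  rw [norm_mul, Real.norm_of_nonneg this, ← mul_assoc C]
  exact mul_le_mul_of_nonneg_right (hc i) this

variable (S) (η) (h)

/-- A majorant of the flux `W_k`, in terms of the weighted moduli of `h`. -/
def fluxMajorant (k : ℕ+) : ℝ :=
  Real.exp (-(η * k)) * (S.a k * S.z) * (S.weight η k * |h k|) + S.a k * S.z * S.Qz k * |h 1|
    + Real.exp (-(η * (k + 1 : ℕ+))) * S.b (k + 1) * (S.weight η (k + 1) * |h (k + 1)|)

theorem abs_W_le (k : ℕ+) : |S.W h k| ≤ S.fluxMajorant η h k := by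
  have ha := S.a_pos k
  have hz := S.z_pos
  have hb := S.b_nonneg (k + 1)
  have hQ := S.Qz_pos k
  have hQ' := S.Qz_pos (k + 1)
  have e : S.W h k = S.a k * S.z * S.Qz k * h k + S.a k * S.z * S.Qz k * h 1
      - S.b (k + 1) * S.Qz (k + 1) * h (k + 1) := by
    rw [b_succ_mul_Qz_succ, W_eq]; ring
  rw [e]
  refine (abs_sub _ _).trans ?_
  refine (add_le_add_left (abs_add_le _ _) _).trans (le_of_eq ?_)
  rw [abs_mul, abs_mul (_ * _ * _), abs_mul (S.b (k + 1) * _), abs_of_pos (by positivity),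
    abs_of_nonneg (by positivity : 0 ≤ S.b (k + 1) * S.Qz (k + 1)), fluxMajorant,
    S.Qz_eq_weight η k, S.Qz_eq_weight η (k + 1)]
  ring

theorem exp_neg_le_one {η : ℝ} (hη : 0 < η) (k : ℕ+) : Real.exp (-(η * k)) ≤ 1 :=
  Real.exp_le_one_iff.2 (by have := PNat.one_le_cast k; nlinarith)

theorem exp_neg_mul_cast_le {η : ℝ} (hη : 0 < η) (k : ℕ+) : Real.exp (-(η * k)) * k ≤ η⁻¹ := by
  have h1 : η * k ≤ Real.exp (η * k) := by linarith [Real.add_one_le_exp (η * k)]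
  rw [Real.exp_neg, inv_mul_le_iff₀ (Real.exp_pos _), ← div_eq_mul_inv, le_div_iff₀ hη]
  linarith

/-- Weighted sum of the moduli of the off-diagonal entries in the column `i` of `L`, relative to
the weight of `i`, apart from the column `1`: the gain terms from the two neighbours, and the
contribution to the equation for the monomers. -/
def colSum (i : ℕ+) : ℝ :=
  Real.exp (-η) * S.b i + Real.exp η * (S.a i * S.z)
    + 2 * Real.exp η * Real.exp (-(η * i)) * (S.a i * S.z + S.b i)

variable {S} {η} {h}

theorem Subcritical.summable_aQz (hS : S.Subcritical η) :
    Summable fun k : ℕ+ => (k : ℝ) * (S.a k * S.z * S.Qz k) := by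
  have hη := hS.eta_pos
  refine Summable.of_nonneg_of_le (fun k => ?_) (fun k => ?_) (hS.summable_weight.mul_left S.z)
  · have := S.a_pos k
    have := S.z_pos
    have := S.Qz_pos k
    positivity
  · have h1 := exp_neg_le_one hη k
    have h2 := S.a_pos k
    have h3 := S.z_pos
    have h4 := S.b_nonneg k
    have h5 := S.weight_pos η k
    rw [S.Qz_eq_weight η k]
    calc (k : ℝ) * (S.a k * S.z * (Real.exp (-(η * k)) * S.weight η k))
        ≤ (k : ℝ) * ((1 + S.a k + S.b k) * S.z * (1 * S.weight η k)) := by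
          gcongr; linarith
      _ = _ := by ring

theorem InX1.tsum_fluxMajorant (hS : S.Subcritical η) (hh : S.InX1 η h) :
    Summable (fun k : ℕ+ => (k : ℝ) * S.fluxMajorant η h k) ∧ Summable (S.fluxMajorant η h) ∧
    ∑' k, S.fluxMajorant η h k =
      ∑' k : ℕ+, Real.exp (-(η * k)) * (S.a k * S.z + S.b k) * (S.weight η k * |h k|)
        + (∑' k, S.a k * S.z * S.Qz k) * |h 1| := by
  have hη := hS.eta_pos
  have hexp := fun k : ℕ+ => exp_neg_le_one hη k
  have hr : ∀ k, 0 < S.a k * S.z := fun k => mul_pos (S.a_pos k) S.z_pos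
  have hb := S.b_nonneg
  have h1' : Summable fun k : ℕ+ => ((k : ℝ) * Real.exp (-(η * k)) * (S.a k * S.z))
      * (S.weight η k * |h k|) := by
    refine hh.summable_mul_of_abs_le (C := η⁻¹) fun k => ?_
    have := hr k
    rw [abs_of_nonneg (by positivity)]
    have := exp_neg_mul_cast_le hη k
    have := S.le_sigma k
    gcongr
    · linarith
    · linarith [hb k]
  have h3' : Summable fun k : ℕ+ => ((k : ℝ) * Real.exp (-(η * k)) * S.b k)
      * (S.weight η k * |h k|) := by
    refine hh.summable_mul_of_abs_le (C := η⁻¹) fun k => ?_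
    have := hb k
    rw [abs_of_nonneg (by positivity)]
    have := exp_neg_mul_cast_le hη k
    have := S.le_sigma k
    gcongr
    · linarith
    · linarith [hr k]
  have h1 : Summable fun k : ℕ+ => (Real.exp (-(η * k)) * (S.a k * S.z))
      * (S.weight η k * |h k|) := by
    refine hh.summable_mul_of_abs_le (C := 1) fun k => ?_
    have := hr k
    rw [abs_of_nonneg (by positivity)]
    have := S.le_sigma k
    gcongr
    · exact hexp k
    · linarith [hb k]
  have h3 : Summable fun k : ℕ+ => (Real.exp (-(η * k)) * S.b k)
      * (S.weight η k * |h k|) := by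
    refine hh.summable_mul_of_abs_le (C := 1) fun k => ?_
    have := hb k
    rw [abs_of_nonneg (by positivity)]
    have := S.le_sigma k
    gcongr
    · exact hexp k
    · linarith [hr k]
  have h2' := (hS.summable_aQz).mul_right |h 1|
  have hpos : ∀ k, 0 < S.a k * S.z * S.Qz k := fun k => mul_pos (hr k) (S.Qz_pos k)
  have h2 : Summable fun k : ℕ+ => S.a k * S.z * S.Qz k := by
    refine Summable.of_nonneg_of_le (fun k => (hpos k).le) (fun k => ?_) hS.summable_aQz
    exact le_mul_of_one_le_left (hpos k).le (PNat.one_le_cast k)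
  have h3s := PNat.summable_iff_shift.2 h3
  refine ⟨?_, (h1.add (h2.mul_right |h 1|)).add h3s, ?_⟩
  · refine Summable.of_nonneg_of_le (fun k => ?_) (fun k => ?_)
      ((h1'.add h2').add (PNat.summable_iff_shift.2 h3'))
    · exact mul_nonneg (by positivity) ((abs_nonneg _).trans (S.abs_W_le η h k))
    · have h4 : 0 ≤ Real.exp (-(η * (k + 1 : ℕ+))) * S.b (k + 1)
          * (S.weight η (k + 1) * |h (k + 1)|) :=
        mul_nonneg (mul_nonneg (Real.exp_pos _).le (hb _))
          (mul_nonneg (S.weight_pos η _).le (abs_nonneg _))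
      rw [fluxMajorant]
      calc _ = (k : ℝ) * Real.exp (-(η * k)) * (S.a k * S.z) * (S.weight η k * |h k|)
            + (k : ℝ) * (S.a k * S.z * S.Qz k) * |h 1|
            + (k : ℝ) * (Real.exp (-(η * (k + 1 : ℕ+))) * S.b (k + 1)
              * (S.weight η (k + 1) * |h (k + 1)|)) := by ring
        _ ≤ (k : ℝ) * Real.exp (-(η * k)) * (S.a k * S.z) * (S.weight η k * |h k|)
            + (k : ℝ) * (S.a k * S.z * S.Qz k) * |h 1|
            + ((k + 1 : ℕ+) : ℝ) * (Real.exp (-(η * (k + 1 : ℕ+))) * S.b (k + 1)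
              * (S.weight η (k + 1) * |h (k + 1)|)) := by
            gcongr
            exact PNat.coe_le_coe _ _ |>.2 (PNat.lt_add_right k 1).le
        _ = _ := by ring
  · have e3 : ∑' k : ℕ+, Real.exp (-(η * (k + 1 : ℕ+))) * S.b (k + 1)
          * (S.weight η (k + 1) * |h (k + 1)|)
        = ∑' k : ℕ+, Real.exp (-(η * k)) * S.b k * (S.weight η k * |h k|) := by
      rw [PNat.tsum_eq_add_shift h3, S.b_one]; simp
    have e : ∀ k : ℕ+, Real.exp (-(η * k)) * (S.a k * S.z + S.b k) * (S.weight η k * |h k|)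
        = Real.exp (-(η * k)) * (S.a k * S.z) * (S.weight η k * |h k|)
          + Real.exp (-(η * k)) * S.b k * (S.weight η k * |h k|) := fun k => by ring
    simp only [fluxMajorant, e]
    rw [(h1.add (h2.mul_right |h 1|)).tsum_add h3s, h1.tsum_add (h2.mul_right |h 1|), e3,
      h1.tsum_add h3, tsum_mul_right]
    ring

theorem InX1.summable_W (hS : S.Subcritical η) (hh : S.InX1 η h) : Summable (S.W h) :=
  Summable.of_norm_bounded (hh.tsum_fluxMajorant hS).2.1 fun k => S.abs_W_le η h k

theorem InX1.summable_mul_W (hS : S.Subcritical η) (hh : S.InX1 η h) :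
    Summable fun k : ℕ+ => (k : ℝ) * S.W h k :=
  Summable.of_norm_bounded (hh.tsum_fluxMajorant hS).1 fun k => by
    rw [norm_mul, Real.norm_of_nonneg (by positivity)]
    exact mul_le_mul_of_nonneg_left (S.abs_W_le η h k) (by positivity)

/-- The off-diagonal part `L + σ` of the operator is controlled by the column sums. -/
theorem Subcritical.exists_offDiag_le (hS : S.Subcritical η) :
    ∃ c, 0 ≤ c ∧ ∀ h, S.InX1 η h →
      (Summable fun i => S.weight η i * |S.L h i + S.sigma i * h i|) ∧
      ∑' i, S.weight η i * |S.L h i + S.sigma i * h i|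
        ≤ ∑' i, (S.colSum η i + if i = 1 then c else 0) * (S.weight η i * |h i|) := by
  have hη := hS.eta_pos
  have hz := S.z_pos
  set q := ∑' k, S.a k * S.z * S.Qz k with hq
  have hsum1 : Summable fun i : ℕ+ => S.weight η i * (S.a i * S.z + S.b i) := by
    refine hS.summable_weight_of_abs_le (C := 1 + S.z) fun i => ?_
    have ha := S.a_pos i
    have hb := S.b_nonneg i
    have hi := PNat.one_le_cast i
    rw [abs_of_pos (S.rate_pos i)]
    calc S.a i * S.z + S.b i ≤ (1 + S.z) * (1 * (1 + S.a i + S.b i)) := by nlinarith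
      _ ≤ _ := by gcongr
  set p := ∑' i : ℕ+, S.weight η (i + 1) * (S.a (i + 1) * S.z + S.b (i + 1)) with hp
  have hp0 : 0 ≤ p := tsum_nonneg fun i => mul_nonneg (S.weight_pos η _).le (S.rate_pos _).le
  have hq0 : 0 ≤ q := tsum_nonneg fun i =>
    mul_nonneg (mul_pos (S.a_pos i) hz).le (S.Qz_pos _).le
  have hw1 := S.weight_pos η 1
  -- The column `1` has infinitely many entries, but a finite weighted sum: the entries for `i ≥ 2`
  -- give `p`, the entry for `i = 1` gives the rest.
  refine ⟨(2 * Real.exp η * q + p) / S.weight η 1 + S.sigma 1,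
    add_nonneg (by positivity) (S.sigma_pos 1).le, fun h hh => ?_⟩
  set c := (2 * Real.exp η * q + p) / S.weight η 1 + S.sigma 1 with hc
  set u : ℕ+ → ℝ := fun i => S.weight η i * |h i| with hu
  have hu0 : ∀ i, 0 ≤ u i := fun i => mul_nonneg (S.weight_pos η i).le (abs_nonneg _)
  obtain ⟨-, hV, hVs⟩ := hh.tsum_fluxMajorant hS
  have hr : ∀ k, 0 < S.a k * S.z := fun k => mul_pos (S.a_pos k) S.z_pos
  -- The two gain terms and the coupling to the monomers.
  have s1 : Summable fun i => Real.exp η * (S.a i * S.z) * u i := by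
    refine hh.summable_mul_of_abs_le (C := Real.exp η) fun i => ?_
    rw [abs_of_pos (mul_pos (Real.exp_pos _) (hr i))]
    gcongr
    linarith [S.le_sigma i, S.b_nonneg i]
  have s2 : Summable fun i => Real.exp (-η) * S.b i * u i := by
    refine hh.summable_mul_of_abs_le (C := Real.exp (-η)) fun i => ?_
    rw [abs_of_nonneg (mul_nonneg (Real.exp_pos _).le (S.b_nonneg i))]
    gcongr
    linarith [S.le_sigma i, hr i]
  have s3 : Summable fun i : ℕ+ => Real.exp (-(η * i)) * (S.a i * S.z + S.b i) * u i := by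
    refine hh.summable_mul_of_abs_le (C := 1) fun i => ?_
    rw [abs_of_nonneg (mul_nonneg (Real.exp_pos _).le (S.rate_pos i).le)]
    exact mul_le_mul (exp_neg_le_one hη i) (by linarith [S.le_sigma i]) (S.rate_pos i).le
      zero_le_one
  have hsucc : ∀ j, S.weight η (j + 1) * |S.L h (j + 1) + S.sigma (j + 1) * h (j + 1)|
      ≤ Real.exp η * (S.a j * S.z) * u j
        + Real.exp (-η) * S.b (j + 1 + 1) * u (j + 1 + 1)
        + S.weight η (j + 1) * (S.a (j + 1) * S.z + S.b (j + 1)) * |h 1| := by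
    intro j
    have hw := S.weight_pos η (j + 1)
    have hbj := S.b_nonneg (j + 1)
    have e : S.L h (j + 1) + S.sigma (j + 1) * h (j + 1) = S.b (j + 1) * h j
        + S.a (j + 1) * S.z * h (j + 1 + 1) + (S.b (j + 1) - S.a (j + 1) * S.z) * h 1 := by
      rw [L_succ, sigma_succ]; ring
    have e1 := S.weight_succ_mul_b_succ η j
    have e2 : S.weight η (j + 1) * (S.a (j + 1) * S.z)
        = Real.exp (-η) * S.b (j + 1 + 1) * S.weight η (j + 1 + 1) := by
      have h3 := S.weight_succ_mul_b_succ η (j + 1)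
      have h4 : Real.exp (-η) * Real.exp η = 1 := by rw [← Real.exp_add]; simp
      linear_combination (-Real.exp (-η)) * h3
        - (S.weight η (j + 1) * (S.a (j + 1) * S.z)) * h4
    have h5 : |S.b (j + 1) - S.a (j + 1) * S.z| ≤ S.a (j + 1) * S.z + S.b (j + 1) := by
      rw [abs_le]; constructor <;> linarith [hr (j + 1)]
    rw [e]
    calc _ ≤ S.weight η (j + 1) * (S.b (j + 1) * |h j| + S.a (j + 1) * S.z * |h (j + 1 + 1)|
          + (S.a (j + 1) * S.z + S.b (j + 1)) * |h 1|) := by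
          refine mul_le_mul_of_nonneg_left ?_ hw.le
          refine (abs_add_le _ _).trans (add_le_add ((abs_add_le _ _).trans (add_le_add ?_ ?_)) ?_)
          · rw [abs_mul, abs_of_nonneg hbj]
          · rw [abs_mul, abs_of_pos (hr (j + 1))]
          · rw [abs_mul]; gcongr
      _ = _ := by
          simp only [hu]
          linear_combination |h j| * e1 + |h (j + 1 + 1)| * e2
  have hone : S.weight η 1 * |S.L h 1 + S.sigma 1 * h 1|
      ≤ 2 * Real.exp η * ∑' k, S.fluxMajorant η h k + S.sigma 1 * u 1 := by
    have h1 : |S.W h 1 + ∑' k, S.W h k| ≤ 2 * ∑' k, S.fluxMajorant η h k := by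
      have h2 : |S.W h 1| ≤ ∑' k, S.fluxMajorant η h k := (S.abs_W_le η h 1).trans
        (hV.le_tsum 1 fun k _ => (abs_nonneg _).trans (S.abs_W_le η h k))
      have h3 : |∑' k, S.W h k| ≤ ∑' k, S.fluxMajorant η h k := by
        rw [← Real.norm_eq_abs]
        exact tsum_of_norm_bounded hV.hasSum fun k => S.abs_W_le η h k
      linarith [abs_add_le (S.W h 1) (∑' k, S.W h k)]
    calc _ ≤ S.weight η 1 * (|S.L h 1| + S.sigma 1 * |h 1|) := by
          gcongr
          refine (abs_add_le _ _).trans ?_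
          rw [abs_mul, abs_of_pos (S.sigma_pos 1)]
      _ = Real.exp η * |S.W h 1 + ∑' k, S.W h k| + S.sigma 1 * u 1 := by
          rw [L_one, abs_mul, abs_neg, abs_of_pos (by positivity)]
          simp only [hu]
          rw [weight_one]
          field_simp
      _ ≤ Real.exp η * (2 * ∑' k, S.fluxMajorant η h k) + S.sigma 1 * u 1 := by gcongr
      _ = _ := by ring
  have s2' := PNat.summable_iff_shift.2 s2
  have s2'' := PNat.summable_iff_shift.2 s2'
  have s4 := (PNat.summable_iff_shift.2 hsum1).mul_right |h 1|
  have hmaj := (s1.add s2'').add s4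
  have hsS : Summable fun j => S.weight η (j + 1) * |S.L h (j + 1) + S.sigma (j + 1) * h (j + 1)| :=
    Summable.of_nonneg_of_le (fun j => mul_nonneg (S.weight_pos η _).le (abs_nonneg _)) hsucc hmaj
  have hsum : Summable fun i => S.weight η i * |S.L h i + S.sigma i * h i| :=
    PNat.summable_iff_shift.1 hsS
  refine ⟨hsum, ?_⟩
  have s5 : HasSum (fun i : ℕ+ => (if i = 1 then c else 0) * u i) (c * u 1) := by
    have := hasSum_single (f := fun i : ℕ+ => (if i = 1 then c else 0) * u i) 1
      (fun i hi => by simp [hi])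
    simpa using this
  have e : ∑' i, (S.colSum η i + if i = 1 then c else 0) * u i
      = ∑' i, Real.exp (-η) * S.b i * u i + ∑' i, Real.exp η * (S.a i * S.z) * u i
        + 2 * Real.exp η * ∑' i : ℕ+, Real.exp (-(η * i)) * (S.a i * S.z + S.b i) * u i
        + c * u 1 := by
    rw [← s5.tsum_eq, ← tsum_mul_left, ← s2.tsum_add s1, ← (s2.add s1).tsum_add (s3.mul_left _),
      ← ((s2.add s1).add (s3.mul_left _)).tsum_add s5.summable]
    refine tsum_congr fun i => ?_
    rw [colSum]; ring
  have hu1 : |h 1| = u 1 / S.weight η 1 := by simp only [hu]; field_simp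
  have hcu : c * u 1 = 2 * Real.exp η * (q * |h 1|) + p * |h 1| + S.sigma 1 * u 1 := by
    rw [hu1, hc]; field_simp
  rw [e, PNat.tsum_eq_add_shift hsum, hcu]
  have f1 := hsS.tsum_le_tsum hsucc hmaj
  rw [(s1.add s2'').tsum_add s4, s1.tsum_add s2'', tsum_mul_right] at f1
  have f2 : ∑' j, Real.exp (-η) * S.b (j + 1 + 1) * u (j + 1 + 1) ≤
      ∑' i, Real.exp (-η) * S.b i * u i := by
    have g0 : ∀ i, 0 ≤ Real.exp (-η) * S.b i * u i := fun i =>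
      mul_nonneg (mul_nonneg (Real.exp_pos _).le (S.b_nonneg i)) (hu0 i)
    exact (PNat.tsum_shift_le s2' fun i => g0 _).trans (PNat.tsum_shift_le s2 g0)
  rw [hVs, ← hq] at hone
  linarith

/-- Far out the column sums are smaller than the diagonal entries by a fixed factor; it is here
that fragmentation has to dominate coagulation by `e ^ (2 η)`. -/
theorem Subcritical.exists_colSum_le (hS : S.Subcritical η) :
    ∃ κ, 0 < κ ∧ κ < 1 ∧ ∀ᶠ i in atTop, S.colSum η i ≤ κ * S.sigma i := by
  have hη := hS.eta_pos
  set x := Real.exp η with hx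
  have hx1 : 1 < x := Real.one_lt_exp_iff.2 hη
  -- The worst case is `b = x ^ 2 a z`, where `x⁻¹ b + x a z = 2 x a z`.
  set κ₁ := 2 * x / (x ^ 2 + 1) with hκ
  have hκ0 : 0 < κ₁ := by positivity
  have hκ1 : κ₁ < 1 := by
    rw [hκ, div_lt_one (by positivity)]; nlinarith [sq_nonneg (x - 1)]
  have hlim : Tendsto (fun i : ℕ+ => 2 * x * Real.exp (-(η * i))) atTop (𝓝 0) := by
    have h1 : Tendsto (fun i : ℕ+ => η * (i : ℝ)) atTop atTop :=
      (tendsto_natCast_atTop_atTop.comp tendsto_PNat_val_atTop_atTop).const_mul_atTop hη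
    simpa using ((Real.tendsto_exp_atBot.comp (tendsto_neg_atTop_atBot.comp h1)).const_mul (2 * x))
  have hε : 0 < (1 - κ₁) / 2 := by linarith
  refine ⟨(1 + κ₁) / 2, by linarith, by linarith, ?_⟩
  filter_upwards [hlim.eventually_lt_const hε, hS.frag] with i hi hfr
  have hr := S.rate_pos i
  have ha := mul_pos (S.a_pos i) S.z_pos
  have e2 : Real.exp (2 * η) = x ^ 2 := by rw [hx, ← Real.exp_nat_mul]; norm_num
  rw [e2] at hfr
  have h1 : Real.exp (-η) * S.b i + x * (S.a i * S.z) ≤ κ₁ * (S.a i * S.z + S.b i) := by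
    rw [Real.exp_neg, ← hx, hκ, div_mul_eq_mul_div, le_div_iff₀ (by positivity)]
    have hx0 : x ≠ 0 := by positivity
    have h2 : 0 ≤ (S.b i - x ^ 2 * (S.a i * S.z)) * (x ^ 2 - 1) / x := by
      have : 0 ≤ x ^ 2 - 1 := by nlinarith
      have : 0 ≤ S.b i - x ^ 2 * (S.a i * S.z) := by linarith
      positivity
    have h3 : 2 * x * (S.a i * S.z + S.b i) - (x⁻¹ * S.b i + x * (S.a i * S.z)) * (x ^ 2 + 1)
        = (S.b i - x ^ 2 * (S.a i * S.z)) * (x ^ 2 - 1) / x := by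
      field_simp; ring
    linarith
  have h4 : 2 * x * Real.exp (-(η * i)) * (S.a i * S.z + S.b i)
      ≤ (1 - κ₁) / 2 * (S.a i * S.z + S.b i) := by gcongr
  calc S.colSum η i ≤ κ₁ * (S.a i * S.z + S.b i) + (1 - κ₁) / 2 * (S.a i * S.z + S.b i) := by
        rw [colSum, ← hx]; linarith
    _ = (1 + κ₁) / 2 * (S.a i * S.z + S.b i) := by ring
    _ ≤ _ := by gcongr; exact S.le_sigma i

end BeckerDoring

/-! ### The space `X` and the resolvent equation -/

namespace BeckerDoring

variable {S : BeckerDoring} {η : ℝ}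

/-- The element of `X` given by a sequence with summable weighted moduli. -/
def mkX (h : ℕ+ → ℝ) (hh : Summable fun i => S.weight η i * |h i|) : S.X η :=
  ⟨h, hh.congr fun i => by rw [abs_of_pos (S.weight_pos η i)]⟩

@[simp] theorem mkX_apply (h : ℕ+ → ℝ) (hh : Summable fun i => S.weight η i * |h i|) (i : ℕ+) :
    (mkX h hh : S.X η) i = h i := rfl

@[simp] theorem X_add_apply (f g : S.X η) (i : ℕ+) : (f + g) i = f i + g i := rfl
@[simp] theorem X_sub_apply (f g : S.X η) (i : ℕ+) : (f - g) i = f i - g i := rfl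
@[simp] theorem X_smul_apply (c : ℝ) (f : S.X η) (i : ℕ+) : (c • f) i = c * f i := rfl

@[ext] theorem X_ext {f g : S.X η} (h : ∀ i, f i = g i) : f = g := Subtype.ext (funext h)

theorem X_norm_eq (f : S.X η) : ‖f‖ = ∑' i, S.weight η i * |f i| := rfl

theorem weight_mul_abs_le_norm (f : S.X η) (i : ℕ+) : S.weight η i * |f i| ≤ ‖f‖ :=
  (S.X_summable f).le_tsum i fun j _ => mul_nonneg (S.weight_pos η j).le (abs_nonneg _)

/-- The isometry `h ↦ (w_i h_i)` of `X` onto the unweighted `ℓ¹`. -/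
def toLp (f : S.X η) : lp (fun _ : ℕ+ => ℝ) 1 :=
  ⟨fun i => S.weight η i * f i, memℓp_gen (by
    simpa [abs_mul, abs_of_pos (S.weight_pos η _)] using S.X_summable f)⟩

instance : CompleteSpace (S.X η) := by
  have hiso : Isometry (toLp : S.X η → lp (fun _ : ℕ+ => ℝ) 1) := by
    refine Isometry.of_dist_eq fun f g => ?_
    rw [dist_eq_norm, dist_eq_norm, lp.norm_eq_tsum_rpow (by simp), X_norm_eq]
    simp only [ENNReal.toReal_one, Real.rpow_one, div_one, Real.norm_eq_abs]
    refine tsum_congr fun i => ?_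
    change |S.weight η i * f i - S.weight η i * g i| = S.weight η i * |f i - g i|
    rw [← mul_sub, abs_mul, abs_of_pos (S.weight_pos η i)]
  have hsurj : Function.Surjective (toLp : S.X η → lp (fun _ : ℕ+ => ℝ) 1) := by
    intro y
    have hy : Summable fun i => |y i| := by
      simpa using (lp.memℓp y).summable (by simp)
    refine ⟨mkX (fun i => y i / S.weight η i) (hy.congr fun i => ?_), ?_⟩
    · have := S.weight_pos η i
      rw [abs_div, abs_of_pos this]
      field_simp
    · ext i
      have := (S.weight_pos η i).ne'
      simp only [toLp, mkX_apply]
      field_simp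
  exact (completeSpace_iff_isComplete_range hiso.isUniformInducing).2
    (by rw [hsurj.range_eq]; exact isComplete_univ)

/-- Multiplication by a bounded sequence. -/
def mulOp (c : ℕ+ → ℝ) {C : ℝ} (hc : ∀ i, |c i| ≤ C) : S.X η →L[ℝ] S.X η :=
  have hle : ∀ (f : S.X η) i, S.weight η i * |c i * f i| ≤ C * (S.weight η i * |f i|) :=
    fun f i => by
    rw [abs_mul, mul_left_comm]
    exact mul_le_mul_of_nonneg_right (hc i) (mul_nonneg (S.weight_pos η i).le (abs_nonneg _))
  have hs : ∀ f : S.X η, Summable fun i => S.weight η i * |c i * f i| := fun f =>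
    Summable.of_nonneg_of_le (fun i => mul_nonneg (S.weight_pos η i).le (abs_nonneg _)) (hle f)
      ((S.X_summable f).mul_left C)
  LinearMap.mkContinuous
    { toFun := fun f => mkX (fun i => c i * f i) (hs f)
      map_add' := fun f g => X_ext fun i => by simp [mul_add]
      map_smul' := fun a f => X_ext fun i => by simp [mul_left_comm] } C fun f => by
    rw [X_norm_eq f, ← tsum_mul_left]
    exact (hs f).tsum_le_tsum (hle f) ((S.X_summable f).mul_left C)

@[simp] theorem mulOp_apply (c : ℕ+ → ℝ) {C : ℝ} (hc : ∀ i, |c i| ≤ C) (f : S.X η) (i : ℕ+) :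
    mulOp c hc f i = c i * f i := rfl

/-- Truncation to the first `n` coordinates. -/
def trunc (S : BeckerDoring) (η : ℝ) (n : ℕ) : S.X η →L[ℝ] S.X η :=
  mulOp (fun i : ℕ+ => if (i : ℕ) ≤ n then 1 else 0) (C := 1) fun i => by split_ifs <;> simp

theorem trunc_apply (n : ℕ) (f : S.X η) (i : ℕ+) :
    trunc S η n f i = if (i : ℕ) ≤ n then f i else 0 := by
  simp [trunc]

theorem norm_trunc_le (n : ℕ) (f : S.X η) : ‖trunc S η n f‖ ≤ ‖f‖ := by
  rw [X_norm_eq, X_norm_eq]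
  refine (S.X_summable _).tsum_le_tsum (fun i => ?_) (S.X_summable f)
  have := S.weight_pos η i
  rw [trunc_apply]
  refine mul_le_mul_of_nonneg_left ?_ this.le
  split_ifs
  · exact le_rfl
  · rw [abs_zero]; exact abs_nonneg _

theorem tendsto_trunc (f : S.X η) : Tendsto (fun n => trunc S η n f) atTop (𝓝 f) := by
  rw [tendsto_iff_norm_sub_tendsto_zero]
  have h := tendsto_tsum_of_dominated_convergence (𝓕 := atTop)
    (f := fun (n : ℕ) i => S.weight η i * |(trunc S η n f - f) i|) (g := fun _ => 0)
    (S.X_summable f) (fun i => ?_) (Eventually.of_forall fun n i => ?_)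
  · simpa [X_norm_eq] using h
  · refine tendsto_const_nhds.congr' ?_
    filter_upwards [eventually_ge_atTop (i : ℕ)] with n hn
    rw [X_sub_apply, trunc_apply, if_pos hn, sub_self, abs_zero, mul_zero]
  · have := S.weight_pos η i
    rw [Real.norm_of_nonneg (by positivity), X_sub_apply, trunc_apply]
    refine mul_le_mul_of_nonneg_left ?_ this.le
    split_ifs
    · rw [sub_self, abs_zero]; exact abs_nonneg _
    · rw [zero_sub, abs_neg]

theorem mem_X1_iff {f : S.X η} : f ∈ S.X1 η ↔ S.InX1 η f := by
  change Summable _ ↔ Summable _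
  refine summable_congr fun i => ?_
  have h1 := S.weight_pos η i
  have h2 := S.sigma_pos i
  rw [abs_of_pos (by positivity), mul_assoc]
  rfl

theorem finite_setOf_coe_le (n : ℕ) : {i : ℕ+ | (i : ℕ) ≤ n}.Finite :=
  (Set.finite_Iic n).preimage PNat.coe_injective.injOn

theorem summable_of_support_le {f : ℕ+ → ℝ} {n : ℕ} (hf : ∀ i : ℕ+, n < (i : ℕ) → f i = 0) :
    Summable f :=
  summable_of_hasFiniteSupport ((finite_setOf_coe_le n).subset fun i hi =>
    not_lt.1 fun h => hi (hf i h))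

theorem inX1_of_support_le {f : ℕ+ → ℝ} {n : ℕ} (hf : ∀ i : ℕ+, n < (i : ℕ) → f i = 0) :
    S.InX1 η f :=
  summable_of_support_le (n := n) fun i hi => by rw [hf i hi]; simp

theorem dense_X1 : Dense (S.X1 η : Set (S.X η)) := fun f =>
  mem_closure_of_tendsto (tendsto_trunc f) (Eventually.of_forall fun n =>
    mem_X1_iff.2 (inX1_of_support_le (n := n) fun i hi => by
      rw [trunc_apply, if_neg (not_le.2 hi)]))

theorem W_add (f g : ℕ+ → ℝ) (i : ℕ+) : S.W (fun i => f i + g i) i = S.W f i + S.W g i := by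
  simp only [W]; ring

theorem W_smul (c : ℝ) (f : ℕ+ → ℝ) (i : ℕ+) : S.W (fun i => c * f i) i = c * S.W f i := by
  simp only [W]; ring

theorem L_add {f g : ℕ+ → ℝ} (hf : Summable (S.W f)) (hg : Summable (S.W g)) (i : ℕ+) :
    S.L (fun i => f i + g i) i = S.L f i + S.L g i := by
  simp only [L, W_add, hf.tsum_add hg]
  split_ifs <;> ring

theorem L_smul (c : ℝ) (f : ℕ+ → ℝ) (i : ℕ+) : S.L (fun i => c * f i) i = c * S.L f i := by
  simp only [L, W_smul, tsum_mul_left]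
  split_ifs <;> ring

variable (S η) in
/-- `o` bounds the gain part `L + σ` of the operator columnwise. -/
structure IsGainBound (o : ℕ+ → ℝ) : Prop where
  nonneg : ∀ i, 0 ≤ o i
  summable : ∀ h, S.InX1 η h → Summable fun i => S.weight η i * |S.L h i + S.sigma i * h i|
  summable_W : ∀ h, S.InX1 η h → Summable (S.W h)
  bound : ∀ h, S.InX1 η h → ∑' i, S.weight η i * |S.L h i + S.sigma i * h i|
    ≤ ∑' i, o i * (S.weight η i * |h i|)

theorem Subcritical.exists_gainBound (hS : S.Subcritical η) :
    ∃ o κ, S.IsGainBound η o ∧ 0 < κ ∧ κ < 1 ∧ ∀ᶠ i in atTop, o i ≤ κ * S.sigma i := by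
  obtain ⟨c, hc, h⟩ := hS.exists_offDiag_le
  obtain ⟨κ, hκ0, hκ1, hκ⟩ := hS.exists_colSum_le
  refine ⟨fun i => S.colSum η i + if i = 1 then c else 0, κ, ⟨fun i => ?_, fun f hf => (h f hf).1,
    fun f hf => hf.summable_W hS, fun f hf => (h f hf).2⟩, hκ0, hκ1, ?_⟩
  · have h1 := mul_pos (S.a_pos i) S.z_pos
    have h2 := S.b_nonneg i
    have h3 := S.rate_pos i
    have h4 : 0 ≤ if i = 1 then c else 0 := by split_ifs <;> simp [hc]
    rw [colSum]
    positivity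
  · filter_upwards [hκ, eventually_gt_atTop 1] with i hi hi1
    simpa [hi1.ne'] using hi

theorem IsGainBound.summable_L {o : ℕ+ → ℝ} (ho : S.IsGainBound η o) {h : ℕ+ → ℝ}
    (hh : S.InX1 η h) : Summable fun i => S.weight η i * |S.L h i| := by
  have h1 := ho.summable h hh
  refine Summable.of_nonneg_of_le (fun i => mul_nonneg (S.weight_pos η i).le (abs_nonneg _))
    (fun i => ?_) (h1.add hh)
  have hw := S.weight_pos η i
  have hs := S.sigma_pos i
  calc S.weight η i * |S.L h i|
      = S.weight η i * |(S.L h i + S.sigma i * h i) - S.sigma i * h i| := by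
        rw [add_sub_cancel_right]
    _ ≤ S.weight η i * (|S.L h i + S.sigma i * h i| + |S.sigma i * h i|) := by
        gcongr; exact abs_sub _ _
    _ = S.weight η i * |S.L h i + S.sigma i * h i| + S.sigma i * (S.weight η i * |h i|) := by
        rw [abs_mul, abs_of_pos hs]; ring
    _ ≤ _ := by gcongr; linarith

/-- The operator `Λ` with domain `X₁`. -/
def IsGainBound.generator {o : ℕ+ → ℝ} (ho : S.IsGainBound η o) : S.X η →ₗ.[ℝ] S.X η where
  domain := S.X1 η
  toFun :=
    { toFun := fun h => mkX (S.L h.1) (ho.summable_L (mem_X1_iff.1 h.2))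
      map_add' := fun f g => X_ext fun i => L_add (ho.summable_W _ (mem_X1_iff.1 f.2))
        (ho.summable_W _ (mem_X1_iff.1 g.2)) i
      map_smul' := fun c _ => X_ext fun i => L_smul c _ i }

theorem IsGainBound.mem_graph_iff {o : ℕ+ → ℝ} (ho : S.IsGainBound η o) {f g : S.X η} :
    (f, g) ∈ ho.generator.graph ↔ S.InX1 η f ∧ ∀ i, S.L f i = g i := by
  rw [LinearPMap.mem_graph_iff]
  constructor
  · rintro ⟨y, hy1, hy2⟩
    simp only at hy1 hy2
    subst hy1
    exact ⟨mem_X1_iff.1 y.2, fun i => by rw [← hy2]; rfl⟩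
  · rintro ⟨h1, h2⟩
    exact ⟨⟨f, mem_X1_iff.2 h1⟩, rfl, X_ext h2⟩

/-- The equation `(p - (L + σ)) h = f`, for a diagonal `p` that dominates the gain part by a factor
`κ < 1`, is solved by a Neumann series in the unknown `u = p h`: the operator
`u ↦ (L + σ) (u / p)` has norm at most `κ`. The truncated equations are solved in the same way, and
their solutions converge. -/
theorem IsGainBound.exists_resolvent {o : ℕ+ → ℝ} (ho : S.IsGainBound η o) {p : ℕ+ → ℝ} {κ C : ℝ}
    (hκ1 : κ < 1) (hp0 : ∀ i, 0 < p i) (hp : ∀ i, 1 + S.sigma i ≤ C * p i)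
    (hop : ∀ i, o i ≤ κ * p i) :
    ∃ R : S.X η →L[ℝ] S.X η, (∀ f, S.InX1 η (R f)) ∧
      (∀ f i, p i * R f i - (S.L (R f) i + S.sigma i * R f i) = f i) ∧
      (∀ f h : S.X η, S.InX1 η h → (∀ i, p i * h i - (S.L h i + S.sigma i * h i) = f i) →
        h = R f) ∧
      (∀ ν, 0 < ν → (∀ i, o i + ν ≤ p i) → ∀ f, ‖R f‖ ≤ ‖f‖ / ν) ∧
      ∀ f, ∃ v : ℕ → S.X η, Tendsto v atTop (𝓝 (R f)) ∧
        (∀ (n : ℕ) (i : ℕ+), n < (i : ℕ) → v n i = 0) ∧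
        ∀ (n : ℕ) (i : ℕ+), (i : ℕ) ≤ n →
          p i * v n i - (S.L (v n) i + S.sigma i * v n i) = f i := by
  have hκ0 : 0 ≤ κ := by
    have h1 := (ho.nonneg 1).trans (hop 1)
    exact nonneg_of_mul_nonneg_left h1 (hp0 1)
  have hbd : ∀ i, |(p i)⁻¹| ≤ C := fun i => by
    rw [abs_of_pos (inv_pos.2 (hp0 i)), inv_le_iff_one_le_mul₀ (hp0 i)]
    linarith [hp i, S.sigma_pos i]
  set D : S.X η →L[ℝ] S.X η := mulOp (fun i => (p i)⁻¹) hbd with hD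
  have hDapp : ∀ u i, D u i = (p i)⁻¹ * u i := fun u i => rfl
  have hDX : ∀ u : S.X η, S.InX1 η (D u) := fun u => by
    refine Summable.of_nonneg_of_le (fun i => ?_) (fun i => ?_) ((S.X_summable u).mul_left C)
    · have := S.sigma_pos i
      have := S.weight_pos η i
      positivity
    · have h1 := hp0 i
      have h2 := S.weight_pos η i
      rw [hDapp, abs_mul, abs_of_pos (inv_pos.2 h1)]
      calc (1 + S.sigma i) * (S.weight η i * ((p i)⁻¹ * |u i|))
          ≤ (C * p i) * (S.weight η i * ((p i)⁻¹ * |u i|)) := by gcongr; exact hp i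
        _ = _ := by field_simp
  have hole : ∀ (u : S.X η) i, o i * (S.weight η i * |D u i|) ≤ κ * (S.weight η i * |u i|) := by
    intro u i
    have h1 := hp0 i
    have h2 := S.weight_pos η i
    rw [hDapp, abs_mul, abs_of_pos (inv_pos.2 h1)]
    calc o i * (S.weight η i * ((p i)⁻¹ * |u i|))
        ≤ (κ * p i) * (S.weight η i * ((p i)⁻¹ * |u i|)) := by gcongr; exact hop i
      _ = _ := by field_simp
  have hosum : ∀ u : S.X η, Summable fun i => o i * (S.weight η i * |D u i|) := fun u =>
    Summable.of_nonneg_of_le (fun i => mul_nonneg (ho.nonneg i)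
      (mul_nonneg (S.weight_pos η i).le (abs_nonneg _))) (hole u) ((S.X_summable u).mul_left κ)
  let K : S.X η →L[ℝ] S.X η := LinearMap.mkContinuous
    { toFun := fun u => mkX (fun i => S.L (D u) i + S.sigma i * D u i) (ho.summable _ (hDX u))
      map_add' := fun u v => X_ext fun i => by
        have h1 := L_add (ho.summable_W _ (hDX u)) (ho.summable_W _ (hDX v)) i
        have h2 : (fun i => D u i + D v i) = (D (u + v) : S.X η) := by rw [map_add]; rfl
        rw [h2] at h1
        rw [X_add_apply, mkX_apply, mkX_apply, mkX_apply, h1, map_add, X_add_apply]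
        ring
      map_smul' := fun c u => X_ext fun i => by
        have h1 := L_smul (S := S) c (D u) i
        have h2 : (fun i => c * D u i) = (D (c • u) : S.X η) := by rw [map_smul]; rfl
        rw [h2] at h1
        rw [RingHom.id_apply, X_smul_apply, mkX_apply, mkX_apply, h1, map_smul, X_smul_apply]
        ring } κ fun u => by
    refine (ho.bound _ (hDX u)).trans ?_
    rw [X_norm_eq, ← tsum_mul_left]
    exact (hosum u).tsum_le_tsum (hole u) ((S.X_summable u).mul_left κ)
  have hKapp : ∀ u i, K u i = S.L (D u) i + S.sigma i * D u i := fun u i => rfl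
  have hKbd : ∀ u, ‖K u‖ ≤ ∑' i, o i * (S.weight η i * |D u i|) := fun u => ho.bound _ (hDX u)
  have hK : ‖K‖ < 1 := lt_of_le_of_lt (LinearMap.mkContinuous_norm_le _ hκ0 _) hκ1
  obtain ⟨U, hU1, hU2⟩ := exists_inverse_one_sub hK
  have hpD : ∀ u i, p i * D u i = u i := fun u i => by
    rw [hDapp, mul_inv_cancel_left₀ (hp0 i).ne']
  refine ⟨D.comp U, fun f => hDX _, fun f i => ?_, fun f h hh hf => ?_, fun ν hν hoν f => ?_,
    fun f => ?_⟩
  · have := congrArg (fun g : S.X η => g i) (hU1 f)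
    simpa only [X_sub_apply, hKapp, ContinuousLinearMap.comp_apply, hpD] using this
  · have hs : Summable fun i => S.weight η i * |p i * h i| := by
      refine Summable.of_nonneg_of_le (fun i => mul_nonneg (S.weight_pos η i).le (abs_nonneg _))
        (fun i => ?_) ((S.X_summable f).add (ho.summable h hh))
      rw [← mul_add]
      refine mul_le_mul_of_nonneg_left ?_ (S.weight_pos η i).le
      rw [← hf i]
      refine le_trans (le_of_eq ?_) (abs_add_le _ _)
      rw [sub_add_cancel]
    have hDh : D (mkX (fun i => p i * h i) hs) = h := X_ext fun i => by
      rw [hDapp, mkX_apply, inv_mul_cancel_left₀ (hp0 i).ne']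
    have hu : mkX (fun i => p i * h i) hs - K (mkX (fun i => p i * h i) hs) = f := X_ext fun i => by
      rw [X_sub_apply, hKapp, hDh, mkX_apply, hf i]
    rw [ContinuousLinearMap.comp_apply, ← hu, hU2, hDh]
  · set u := U f with hu
    have h1 : ‖u‖ ≤ ‖f‖ + ‖K u‖ := by
      calc ‖u‖ = ‖f + K u‖ := by rw [← hU1 f, ← hu, sub_add_cancel]
        _ ≤ _ := norm_add_le _ _
    rw [ContinuousLinearMap.comp_apply, ← hu, le_div_iff₀ hν]
    have h2 : ‖D u‖ * ν + ∑' i, o i * (S.weight η i * |D u i|) ≤ ‖u‖ := by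
      rw [X_norm_eq, X_norm_eq, ← tsum_mul_right,
        ← ((S.X_summable (D u)).mul_right ν).tsum_add (hosum u)]
      refine (((S.X_summable (D u)).mul_right ν).add (hosum u)).tsum_le_tsum (fun i => ?_)
        (S.X_summable u)
      have h3 : |u i| = p i * |D u i| := by rw [← hpD u i, abs_mul, abs_of_pos (hp0 i)]
      rw [h3]
      have h4 : 0 ≤ S.weight η i * |D u i| := mul_nonneg (S.weight_pos η i).le (abs_nonneg _)
      calc _ = (o i + ν) * (S.weight η i * |D u i|) := by ring
        _ ≤ p i * (S.weight η i * |D u i|) := by gcongr; exact hoν i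
        _ = _ := by ring
    linarith [hKbd u]
  · obtain ⟨v, hv, hvlim⟩ := exists_tendsto_galerkin hK (norm_trunc_le (S := S) (η := η))
      tendsto_trunc (hU1 f)
    have hv0 : ∀ (n : ℕ) (i : ℕ+), n < (i : ℕ) → v n i = 0 := fun n i hi => by
      have := congrArg (fun g : S.X η => g i) (hv n)
      simp only [X_sub_apply, trunc_apply] at this
      rwa [if_neg (not_le.2 hi), if_neg (not_le.2 hi), sub_zero] at this
    have hPv : ∀ n, trunc S η n (v n) = v n := fun n => X_ext fun i => by
      rw [trunc_apply]
      split_ifs with h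
      · rfl
      · exact (hv0 n i (not_le.1 h)).symm
    refine ⟨fun n => D (v n), (D.continuous.tendsto _).comp hvlim, fun n i hi => ?_,
      fun n i hi => ?_⟩
    · rw [hDapp, hv0 n i hi, mul_zero]
    · have := congrArg (fun g : S.X η => g i) (hv n)
      simp only [hPv, X_sub_apply, trunc_apply] at this
      rw [if_pos hi, if_pos hi] at this
      rw [hpD, ← hKapp, this]

end BeckerDoring

/-! ### The Dirichlet form and the spectral gap -/

namespace BeckerDoring

variable {S : BeckerDoring} {η : ℝ}

/-- Summation by parts: the weak form of the linearized operator. -/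
theorem tsum_Qz_mul_L {φ h : ℕ+ → ℝ} (h0 : Summable (S.W h))
    (h1 : Summable fun k => φ k * S.W h k) (h2 : Summable fun k => φ (k + 1) * S.W h k) :
    ∑' i, S.Qz i * (φ i * S.L h i) = ∑' k, S.W h k * (φ (k + 1) - φ k - φ 1) := by
  have e : ∀ j, S.Qz (j + 1) * (φ (j + 1) * S.L h (j + 1))
      = φ (j + 1) * S.W h j - φ (j + 1) * S.W h (j + 1) := fun j => by
    rw [← mul_sub, ← Qz_mul_L_succ]; ring
  have h1' : Summable fun j => φ (j + 1) * S.W h (j + 1) :=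
    PNat.summable_iff_shift (f := fun k => φ k * S.W h k).2 h1
  have hs : Summable fun i => S.Qz i * (φ i * S.L h i) :=
    PNat.summable_iff_shift (f := fun i => S.Qz i * (φ i * S.L h i)).1
      ((h2.sub h1').congr fun j => (e j).symm)
  have e2 : ∀ k, S.W h k * (φ (k + 1) - φ k - φ 1)
      = φ (k + 1) * S.W h k - φ k * S.W h k - φ 1 * S.W h k := fun k => by ring
  have e3 : S.Qz 1 * (φ 1 * S.L h 1) = -(φ 1 * (S.W h 1 + ∑' k, S.W h k)) := by
    have := S.z_pos.ne'
    rw [L_one, Qz_one]; field_simp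
  have e4 : ∑' k, S.W h k * (φ (k + 1) - φ k - φ 1)
      = ∑' k, φ (k + 1) * S.W h k - ∑' k, φ k * S.W h k - φ 1 * ∑' k, S.W h k := by
    rw [tsum_congr e2, (h2.sub h1).tsum_sub (h0.mul_left (φ 1)), h2.tsum_sub h1, tsum_mul_left]
  have e5 : ∑' k, φ k * S.W h k = φ 1 * S.W h 1 + ∑' j, φ (j + 1) * S.W h (j + 1) :=
    PNat.tsum_eq_add_shift h1
  rw [PNat.tsum_eq_add_shift hs, tsum_congr e, h2.tsum_sub h1', e4, e5, e3]
  ring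

/-- Conservation of mass. -/
theorem InX1.tsum_mass_L (hS : S.Subcritical η) {h : ℕ+ → ℝ} (hh : S.InX1 η h) :
    ∑' i : ℕ+, (i : ℝ) * S.Qz i * S.L h i = 0 := by
  have h1 := hh.summable_W hS
  have h2 := hh.summable_mul_W hS
  have h3 := tsum_Qz_mul_L (φ := fun i => (i : ℝ)) h1 h2
    ((h2.add h1).congr fun k => by push_cast; ring)
  have h4 : ∀ k : ℕ+, S.W h k * (((k + 1 : ℕ+) : ℝ) - k - (1 : ℕ+)) = 0 := fun k => by
    push_cast; ring
  simp only [h4, tsum_zero] at h3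
  rw [← h3]
  exact tsum_congr fun i => by ring

variable (S) in
/-- The Dirichlet form of the linearized operator. -/
def dirichlet (h : ℕ+ → ℝ) : ℝ := ∑' k, S.a k * S.z * S.Qz k * (h k + h 1 - h (k + 1)) ^ 2

theorem summable_W_of_support_le (hS : S.Subcritical η) {h : ℕ+ → ℝ} {n : ℕ}
    (hn : ∀ i : ℕ+, n < (i : ℕ) → h i = 0) : Summable (S.W h) :=
  (inX1_of_support_le (η := η) hn).summable_W hS

theorem lt_coe_succ {n : ℕ} {i : ℕ+} (hi : n < (i : ℕ)) : n < ((i + 1 : ℕ+) : ℕ) :=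
  hi.trans (PNat.coe_lt_coe _ _ |>.2 (PNat.lt_add_right i 1))

/-- The weak form tested with a finitely supported sequence. -/
theorem tsum_Qz_mul_L_of_support_le {φ h : ℕ+ → ℝ} {n : ℕ} (h0 : Summable (S.W h))
    (hn : ∀ i : ℕ+, n < (i : ℕ) → φ i = 0) :
    (Summable fun k => S.W h k * (φ (k + 1) - φ k - φ 1)) ∧
    ∑' i, S.Qz i * (φ i * S.L h i) = ∑' k, S.W h k * (φ (k + 1) - φ k - φ 1) := by
  have h1 : Summable fun k => φ k * S.W h k :=
    summable_of_support_le (n := n) fun i hi => by rw [hn i hi, zero_mul]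
  have h2 : Summable fun k => φ (k + 1) * S.W h k :=
    summable_of_support_le (n := n) fun i hi => by rw [hn _ (lt_coe_succ hi), zero_mul]
  exact ⟨((h2.sub h1).sub (h0.mul_left (φ 1))).congr fun k => by ring, tsum_Qz_mul_L h0 h1 h2⟩

theorem tsum_energy (hS : S.Subcritical η) {h : ℕ+ → ℝ} {n : ℕ}
    (hn : ∀ i : ℕ+, n < (i : ℕ) → h i = 0) :
    (Summable fun k => S.a k * S.z * S.Qz k * (h k + h 1 - h (k + 1)) ^ 2) ∧
    ∑' i, S.Qz i * (h i * S.L h i) = -S.dirichlet h := by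
  obtain ⟨h1, h2⟩ := tsum_Qz_mul_L_of_support_le (summable_W_of_support_le hS hn) hn
  have e : ∀ k, S.W h k * (h (k + 1) - h k - h 1)
      = -(S.a k * S.z * S.Qz k * (h k + h 1 - h (k + 1)) ^ 2) := fun k => by rw [W_eq]; ring
  refine ⟨by simpa using (h1.congr e).neg, ?_⟩
  rw [h2, dirichlet, ← tsum_neg]
  exact tsum_congr e

theorem exists_support_le {h : ℕ+ → ℝ} (hh : h.support.Finite) :
    ∃ n : ℕ, ∀ i : ℕ+, n < (i : ℕ) → h i = 0 := by
  obtain ⟨m, hm⟩ := hh.bddAbove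
  refine ⟨m, fun i hi => ?_⟩
  by_contra h0
  exact absurd (PNat.coe_le_coe _ _ |>.2 (hm h0)) (not_le.2 hi)

theorem finite_support_of_support_le {h : ℕ+ → ℝ} {n : ℕ}
    (hn : ∀ i : ℕ+, n < (i : ℕ) → h i = 0) : h.support.Finite :=
  (finite_setOf_coe_le n).subset fun i hi => not_lt.1 fun h' => hi (hn i h')

/-- A discrete **Hardy inequality**: since `𝒬` decays geometrically, a sequence is controlled in
`ℓ²(𝒬)` by its increments. -/
theorem Subcritical.exists_hardy (hS : S.Subcritical η) :
    ∃ C, 0 < C ∧ ∀ s : ℕ+ → ℝ, s 1 = 0 → (Summable fun i => S.Qz i * s i ^ 2) →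
      (Summable fun i => S.Qz i * (s (i + 1) - s i) ^ 2) →
      ∑' i, S.Qz i * s i ^ 2 ≤ C * ∑' i, S.Qz i * (s (i + 1) - s i) ^ 2 := by
  obtain ⟨θ, hθ0, hθ1, hθ⟩ := hS.ratio
  obtain ⟨N, hN⟩ := eventually_atTop.1 hθ
  -- Each single term is controlled, with a constant that depends on the index.
  have hterm : ∀ i, ∃ C, 0 ≤ C ∧ ∀ s : ℕ+ → ℝ, s 1 = 0 →
      (Summable fun i => S.Qz i * (s (i + 1) - s i) ^ 2) →
      S.Qz i * s i ^ 2 ≤ C * ∑' i, S.Qz i * (s (i + 1) - s i) ^ 2 := by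
    intro i
    induction i using PNat.recOn with
    | one => exact ⟨0, le_rfl, fun s hs _ => by simp [hs]⟩
    | succ i ih =>
      obtain ⟨C, hC, h⟩ := ih
      have hQ := S.Qz_pos i
      have hQ' := S.Qz_pos (i + 1)
      refine ⟨S.Qz (i + 1) / S.Qz i * (2 * C + 2), by positivity, fun s hs hsum => ?_⟩
      have h1 := h s hs hsum
      have h2 : S.Qz i * (s (i + 1) - s i) ^ 2 ≤ ∑' i, S.Qz i * (s (i + 1) - s i) ^ 2 :=
        hsum.le_tsum i fun j _ => mul_nonneg (S.Qz_pos j).le (sq_nonneg _)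
      have h3 : s (i + 1) ^ 2 ≤ 2 * s i ^ 2 + 2 * (s (i + 1) - s i) ^ 2 := by
        nlinarith [sq_nonneg (s (i + 1) - 2 * s i)]
      calc S.Qz (i + 1) * s (i + 1) ^ 2
          ≤ S.Qz (i + 1) * (2 * s i ^ 2 + 2 * (s (i + 1) - s i) ^ 2) := by gcongr
        _ = S.Qz (i + 1) / S.Qz i
            * (2 * (S.Qz i * s i ^ 2) + 2 * (S.Qz i * (s (i + 1) - s i) ^ 2)) := by field_simp
        _ ≤ S.Qz (i + 1) / S.Qz i * (2 * (C * ∑' i, S.Qz i * (s (i + 1) - s i) ^ 2)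
            + 2 * ∑' i, S.Qz i * (s (i + 1) - s i) ^ 2) := by gcongr
        _ = _ := by ring
  choose C hC hCs using hterm
  have hε : 0 < (1 - θ) / (2 * θ) := div_pos (by linarith) (by linarith)
  -- `ε` is chosen such that `θ (1 + ε) = (1 + θ) / 2 < 1`.
  set ε := (1 - θ) / (2 * θ) with hεdef
  set c := θ * (1 + ε⁻¹) with hc
  have hc0 : 0 < c := by positivity
  set B := ∑ i ∈ Finset.Iio N, C (i + 1) with hB
  have hB0 : 0 ≤ B := Finset.sum_nonneg fun i _ => hC _
  have hθ' : 0 < (1 - θ) / 2 := by linarith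
  refine ⟨(c + B) / ((1 - θ) / 2), by positivity, fun s hs hsum hr => ?_⟩
  set G := ∑' i, S.Qz i * (s (i + 1) - s i) ^ 2 with hG
  set F := ∑' i, S.Qz i * s i ^ 2 with hF
  have hshift : F = ∑' i, S.Qz (i + 1) * s (i + 1) ^ 2 := by
    rw [hF, PNat.tsum_eq_add_shift hsum, hs]; simp
  -- The finitely many indices where `𝒬` need not decay are collected in `δ`.
  set δ : ℕ+ → ℝ := fun i => if i < N then S.Qz (i + 1) * s (i + 1) ^ 2 else 0 with hδ
  have hδ0 : ∀ i ∉ Finset.Iio N, δ i = 0 := fun i hi => by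
    simp only [hδ]; rw [if_neg (by simpa using hi)]
  have hδs : Summable δ := summable_of_ne_finset_zero hδ0
  have hδB : ∑' i, δ i ≤ B * G := by
    rw [tsum_eq_sum hδ0, hB, Finset.sum_mul]
    refine Finset.sum_le_sum fun i hi => ?_
    simp only [hδ]
    rw [if_pos (by simpa using hi)]
    exact hCs (i + 1) s hs hr
  have hle : ∀ i, S.Qz (i + 1) * s (i + 1) ^ 2 ≤
      (1 + θ) / 2 * (S.Qz i * s i ^ 2) + c * (S.Qz i * (s (i + 1) - s i) ^ 2) + δ i := by
    intro i
    have hQ := S.Qz_pos i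
    by_cases hi : i < N
    · simp only [hδ]
      rw [if_pos hi]
      exact le_add_of_nonneg_left (by positivity)
    · have hδi : δ i = 0 := by simp only [hδ]; rw [if_neg hi]
      rw [hδi, add_zero]
      have h1 : s (i + 1) ^ 2 ≤ (1 + ε) * s i ^ 2 + (1 + ε⁻¹) * (s (i + 1) - s i) ^ 2 := by
        have h2 : (1 + ε) * s i ^ 2 + (1 + ε⁻¹) * (s (i + 1) - s i) ^ 2 - s (i + 1) ^ 2
            = ε⁻¹ * (ε * s i - (s (i + 1) - s i)) ^ 2 := by field_simp; ring
        have h3 : 0 ≤ ε⁻¹ * (ε * s i - (s (i + 1) - s i)) ^ 2 := by positivity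
        linarith
      have h4 : θ * (1 + ε) = (1 + θ) / 2 := by rw [hεdef]; field_simp; ring
      calc _ ≤ (θ * S.Qz i) * s (i + 1) ^ 2 := by gcongr; exact hN i (not_lt.1 hi)
        _ ≤ (θ * S.Qz i) * ((1 + ε) * s i ^ 2 + (1 + ε⁻¹) * (s (i + 1) - s i) ^ 2) := by gcongr
        _ = _ := by rw [← h4, hc]; ring
  have hsum' := ((hsum.mul_left ((1 + θ) / 2)).add (hr.mul_left c)).add hδs
  have h5 := (PNat.summable_iff_shift.2 hsum).tsum_le_tsum hle hsum'
  rw [((hsum.mul_left ((1 + θ) / 2)).add (hr.mul_left c)).tsum_add hδs,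
    (hsum.mul_left ((1 + θ) / 2)).tsum_add (hr.mul_left c), tsum_mul_left, tsum_mul_left,
    ← hshift, ← hF, ← hG] at h5
  rw [div_mul_eq_mul_div, le_div_iff₀ hθ']
  linarith

theorem Subcritical.summable_sq_Qz (hS : S.Subcritical η) :
    Summable fun i : ℕ+ => (i : ℝ) ^ 2 * S.Qz i := by
  refine Summable.of_nonneg_of_le (fun i => ?_) (fun i => ?_) hS.summable_sq
  · exact mul_nonneg (sq_nonneg _) (S.Qz_pos i).le
  · have h1 : (1 : ℝ) ≤ (1 + S.a i + S.b i) ^ 2 :=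
      one_le_pow₀ (by linarith [S.a_pos i, S.b_nonneg i])
    have := S.Qz_pos i
    gcongr
    exact le_mul_of_one_le_right (sq_nonneg _) h1

/-- The Poincaré inequality behind the spectral gap, with a constant that is not optimal. -/
theorem Subcritical.exists_poincare (hS : S.Subcritical η) :
    ∃ l, 0 < l ∧ ∀ (h : ℕ+ → ℝ) (n : ℕ), (∀ i : ℕ+, n < (i : ℕ) → h i = 0) →
      ∑' i : ℕ+, (i : ℝ) * S.Qz i * h i = 0 →
      l * ∑' i, S.Qz i * h i ^ 2 ≤ S.dirichlet h := by
  obtain ⟨C, hC, hardy⟩ := hS.exists_hardy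
  obtain ⟨c, hc, hca⟩ := hS.exists_le_a
  have hz := S.z_pos
  refine ⟨c * S.z / C, by positivity, fun h n hn hm => ?_⟩
  set s : ℕ+ → ℝ := fun i => h i - i * h 1 with hs
  have hD := (tsum_energy hS hn).1
  have e : ∀ k, (s (k + 1) - s k) ^ 2 = (h k + h 1 - h (k + 1)) ^ 2 := fun k => by
    simp only [hs]; push_cast; ring
  have hle : ∀ k, S.Qz k * (s (k + 1) - s k) ^ 2 ≤
      (c * S.z)⁻¹ * (S.a k * S.z * S.Qz k * (h k + h 1 - h (k + 1)) ^ 2) := fun k => by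
    have hQ := S.Qz_pos k
    rw [e, inv_mul_eq_div, le_div_iff₀ (by positivity)]
    calc _ = c * S.z * S.Qz k * (h k + h 1 - h (k + 1)) ^ 2 := by ring
      _ ≤ _ := by gcongr; exact hca k
  have hr : Summable fun k => S.Qz k * (s (k + 1) - s k) ^ 2 :=
    Summable.of_nonneg_of_le (fun k => mul_nonneg (S.Qz_pos k).le (sq_nonneg _)) hle
      (hD.mul_left _)
  have t1 : Summable fun i => S.Qz i * h i ^ 2 :=
    summable_of_support_le fun i hi => by rw [hn i hi]; simp
  have t2 : Summable fun i : ℕ+ => (i : ℝ) * S.Qz i * h i :=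
    summable_of_support_le fun i hi => by rw [hn i hi]; simp
  have t3 := hS.summable_sq_Qz
  have e2 : ∀ i, S.Qz i * s i ^ 2
      = S.Qz i * h i ^ 2 - 2 * h 1 * (i * S.Qz i * h i) + h 1 ^ 2 * ((i : ℝ) ^ 2 * S.Qz i) :=
    fun i => by simp only [hs]; ring
  have t4 := (t1.sub (t2.mul_left (2 * h 1))).add (t3.mul_left (h 1 ^ 2))
  have hss : Summable fun i => S.Qz i * s i ^ 2 := t4.congr fun i => (e2 i).symm
  -- `h` is the orthogonal projection of `s` onto the sequences of zero mass.
  have h1 : ∑' i, S.Qz i * h i ^ 2 ≤ ∑' i, S.Qz i * s i ^ 2 := by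
    rw [tsum_congr e2, (t1.sub (t2.mul_left (2 * h 1))).tsum_add (t3.mul_left (h 1 ^ 2)),
      t1.tsum_sub (t2.mul_left (2 * h 1)), tsum_mul_left, tsum_mul_left, hm]
    have : 0 ≤ ∑' i : ℕ+, (i : ℝ) ^ 2 * S.Qz i :=
      tsum_nonneg fun i => mul_nonneg (sq_nonneg _) (S.Qz_pos i).le
    nlinarith [mul_nonneg (sq_nonneg (h 1)) this]
  have h2 := hardy s (by simp [hs]) hss hr
  have h3 : ∑' k, S.Qz k * (s (k + 1) - s k) ^ 2 ≤ (c * S.z)⁻¹ * S.dirichlet h := by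
    rw [dirichlet, ← tsum_mul_left]
    exact hr.tsum_le_tsum hle (hD.mul_left _)
  rw [div_mul_eq_mul_div, div_le_iff₀ hC]
  calc c * S.z * ∑' i, S.Qz i * h i ^ 2 ≤ c * S.z * (C * ((c * S.z)⁻¹ * S.dirichlet h)) := by
        gcongr
        exact h1.trans (h2.trans (by gcongr))
    _ = S.dirichlet h * C := by field_simp

variable (S) in
/-- The set of rates whose supremum is the spectral gap. -/
def gapSet : Set ℝ :=
  {l : ℝ | 0 ≤ l ∧ ∀ h : ℕ+ → ℝ, h.support.Finite → ∑' i : ℕ+, (i : ℝ) * S.Qz i * h i = 0 →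
    ∑' i, S.Qz i * (h i * S.L h i) ≤ -l * ∑' i, S.Qz i * h i ^ 2}

theorem Subcritical.bddAbove_gapSet (hS : S.Subcritical η) : BddAbove S.gapSet := by
  -- Any nonzero test sequence of zero mass gives a bound.
  set h : ℕ+ → ℝ := fun i => if i = 1 then 2 * S.Qz 2 else if i = 2 then -S.Qz 1 else 0 with hh
  have h12 : (1 : ℕ+) ≠ 2 := by decide
  have hh1 : h 1 = 2 * S.Qz 2 := by simp [hh]
  have hh2 : h 2 = -S.Qz 1 := by simp [hh]
  have h0 : ∀ i ∉ ({1, 2} : Finset ℕ+), h i = 0 := fun i hi => by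
    simp only [Finset.mem_insert, Finset.mem_singleton, not_or] at hi
    simp [hh, hi.1, hi.2]
  have hfin : h.support.Finite := (Finset.finite_toSet {1, 2}).subset fun i hi => by
    by_contra hc
    exact hi (h0 i hc)
  obtain ⟨n, hn⟩ := exists_support_le hfin
  have hmass : ∑' i : ℕ+, (i : ℝ) * S.Qz i * h i = 0 := by
    rw [tsum_eq_sum (s := {1, 2}) fun i hi => by rw [h0 i hi, mul_zero], Finset.sum_pair h12, hh1,
      hh2]
    have : ((2 : ℕ+) : ℝ) = 2 := by norm_cast
    rw [this]; push_cast; ring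
  have hpos : 0 < ∑' i, S.Qz i * h i ^ 2 := by
    have hs : Summable fun i => S.Qz i * h i ^ 2 :=
      summable_of_support_le fun i hi => by rw [hn i hi]; simp
    refine hs.tsum_pos (fun i => mul_nonneg (S.Qz_pos i).le (sq_nonneg _)) 1 ?_
    have := S.Qz_pos 1
    have := S.Qz_pos 2
    rw [hh1]; positivity
  refine ⟨S.dirichlet h / ∑' i, S.Qz i * h i ^ 2, fun l hl => ?_⟩
  rw [le_div_iff₀ hpos]
  have := hl.2 h hfin hmass
  rw [(tsum_energy hS hn).2] at this
  linarith

theorem Subcritical.spectralGap_pos (hS : S.Subcritical η) : 0 < S.spectralGap := by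
  obtain ⟨l, hl, h⟩ := hS.exists_poincare
  refine hl.trans_le (le_csSup hS.bddAbove_gapSet ⟨hl.le, fun f hf hm => ?_⟩)
  obtain ⟨n, hn⟩ := exists_support_le hf
  rw [(tsum_energy hS hn).2]
  linarith [h f n hn hm]

/-- The supremum in the definition of the spectral gap is attained. -/
theorem Subcritical.spectralGap_mul_le (hS : S.Subcritical η) {h : ℕ+ → ℝ} {n : ℕ}
    (hn : ∀ i : ℕ+, n < (i : ℕ) → h i = 0) (hm : ∑' i : ℕ+, (i : ℝ) * S.Qz i * h i = 0) :
    S.spectralGap * ∑' i, S.Qz i * h i ^ 2 ≤ S.dirichlet h := by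
  have h0 : 0 ≤ ∑' i, S.Qz i * h i ^ 2 :=
    tsum_nonneg fun i => mul_nonneg (S.Qz_pos i).le (sq_nonneg _)
  have hle : ∀ l ∈ S.gapSet, l * ∑' i, S.Qz i * h i ^ 2 ≤ S.dirichlet h := fun l hl => by
    have := hl.2 h (finite_support_of_support_le hn) hm
    rw [(tsum_energy hS hn).2] at this
    linarith
  have hne : S.gapSet.Nonempty := by
    obtain ⟨l, hl, h⟩ := hS.exists_poincare
    refine ⟨l, hl.le, fun f hf hm => ?_⟩
    obtain ⟨n, hn⟩ := exists_support_le hf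
    rw [(tsum_energy hS hn).2]
    linarith [h f n hn hm]
  rcases h0.eq_or_lt with h0 | h0
  · obtain ⟨l, hl⟩ := hne
    have := hle l hl
    rw [← h0, mul_zero] at this ⊢
    exact this
  · rw [← le_div_iff₀ h0]
    exact csSup_le hne fun l hl => (le_div_iff₀ h0).2 (hle l hl)

end BeckerDoring

/-! ### The embedding of `ℓ²(𝒬)` and the resolvent there -/

namespace BeckerDoring

variable {S : BeckerDoring} {η : ℝ}

/-- The gap inequality for a solution `v` of the resolvent equation truncated at `n`, which need not
have zero mass: `v - c δ₁` has, with `c` the mass of `v` divided by `z`, and the correction is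
bounded in terms of `c` and the first coordinates alone. -/
theorem Subcritical.energy_bound (hS : S.Subcritical η) {v f : ℕ+ → ℝ} {n : ℕ} {l : ℝ} (hl : 0 < l)
    (hn : ∀ i : ℕ+, n < (i : ℕ) → v i = 0)
    (heq : ∀ i : ℕ+, (i : ℕ) ≤ n → l * v i - S.L v i = f i)
    (hf : Summable fun i => S.Qz i * f i ^ 2) {c : ℝ}
    (hc : c * S.z = ∑' i : ℕ+, (i : ℝ) * S.Qz i * v i) :
    (l + S.spectralGap) ^ 2 * ∑' i, S.Qz i * v i ^ 2 ≤ ∑' i, S.Qz i * f i ^ 2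
      + 2 * (l + S.spectralGap) * (2 * c * S.z * S.L v 1
        + c ^ 2 * S.dirichlet (fun i => if i = 1 then 1 else 0)
        + S.spectralGap * (2 * c * S.z * v 1 - c ^ 2 * S.z)) := by
  set g := S.spectralGap with hg
  have hg0 : 0 < g := hS.spectralGap_pos
  set e : ℕ+ → ℝ := fun i => if i = 1 then 1 else 0 with he
  have he1 : e 1 = 1 := by simp [he]
  have he0 : ∀ i, i ≠ 1 → e i = 0 := fun i hi => by simp [he, hi]
  have hen : ∀ i : ℕ+, 1 < (i : ℕ) → e i = 0 := fun i hi => he0 i (by rintro rfl; simp at hi)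
  have single : ∀ u : ℕ+ → ℝ, HasSum (fun i => e i * u i) (u 1) := fun u => by
    have := hasSum_single (f := fun i => e i * u i) 1 fun i hi => by rw [he0 i hi, zero_mul]
    simpa only [he1, one_mul] using this
  have q1 : Summable fun i => S.Qz i * v i ^ 2 :=
    summable_of_support_le fun i hi => by rw [hn i hi]; simp
  have q2 : Summable fun i : ℕ+ => (i : ℝ) * S.Qz i * v i :=
    summable_of_support_le fun i hi => by rw [hn i hi]; simp
  have q3 : Summable fun i => S.Qz i * (v i * f i) :=
    summable_of_support_le fun i hi => by rw [hn i hi]; simp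
  -- The corrected sequence.
  set u : ℕ+ → ℝ := fun i => v i - c * e i with hu
  have hun : ∀ i : ℕ+, max n 1 < (i : ℕ) → u i = 0 := fun i hi => by
    simp only [hu]
    rw [hn i ((le_max_left _ _).trans_lt hi), hen i ((le_max_right _ _).trans_lt hi)]
    simp
  have hmass : ∑' i : ℕ+, (i : ℝ) * S.Qz i * u i = 0 := by
    have h1 := single fun i => c * ((i : ℝ) * S.Qz i)
    have h2 : ∀ i : ℕ+, (i : ℝ) * S.Qz i * u i
        = (i : ℝ) * S.Qz i * v i - e i * (c * ((i : ℝ) * S.Qz i)) := fun i => by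
      simp only [hu]; ring
    rw [tsum_congr h2, q2.tsum_sub h1.summable, h1.tsum_eq, ← hc, Qz_one]
    simp
  have hgap := hS.spectralGap_mul_le hun hmass
  have hnorm : ∑' i, S.Qz i * u i ^ 2 =
      ∑' i, S.Qz i * v i ^ 2 - 2 * c * S.z * v 1 + c ^ 2 * S.z := by
    have h1 := single fun i => 2 * c * S.Qz i * v i
    have h2 := single fun i => c ^ 2 * S.Qz i
    have h3 : ∀ i, S.Qz i * u i ^ 2
        = S.Qz i * v i ^ 2 - e i * (2 * c * S.Qz i * v i) + e i * (c ^ 2 * S.Qz i) := fun i => by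
      have h4 : e i ^ 2 = e i := by
        by_cases hi : i = 1
        · rw [hi, he1]; norm_num
        · rw [he0 i hi]; norm_num
      simp only [hu]
      linear_combination (c ^ 2 * S.Qz i) * h4
    rw [tsum_congr h3, (q1.sub h1.summable).tsum_add h2.summable, q1.tsum_sub h1.summable,
      h1.tsum_eq, h2.tsum_eq, Qz_one]
  obtain ⟨d1, d2⟩ := tsum_energy hS hn
  obtain ⟨d3, -⟩ := tsum_energy hS hen
  obtain ⟨d5, d6⟩ := tsum_Qz_mul_L_of_support_le (summable_W_of_support_le hS hn) hen
  have hL1 : S.z * S.L v 1 = ∑' k, S.W v k * (e (k + 1) - e k - e 1) := by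
    have h1 := single fun i => S.Qz i * S.L v i
    rw [← d6, ← Qz_one, ← h1.tsum_eq]
    exact tsum_congr fun i => by ring
  have hdir : S.dirichlet u = S.dirichlet v + 2 * c * S.z * S.L v 1 + c ^ 2 * S.dirichlet e := by
    have h3 : ∀ k, S.a k * S.z * S.Qz k * (u k + u 1 - u (k + 1)) ^ 2
        = S.a k * S.z * S.Qz k * (v k + v 1 - v (k + 1)) ^ 2
          + 2 * c * (S.W v k * (e (k + 1) - e k - e 1))
          + c ^ 2 * (S.a k * S.z * S.Qz k * (e k + e 1 - e (k + 1)) ^ 2) := fun k => by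
      simp only [hu]; rw [W_eq]; ring
    rw [dirichlet, tsum_congr h3, (d1.add (d5.mul_left (2 * c))).tsum_add (d3.mul_left (c ^ 2)),
      d1.tsum_add (d5.mul_left (2 * c)), tsum_mul_left, tsum_mul_left, ← hL1, dirichlet, dirichlet]
    ring
  have hdv : S.dirichlet v = ∑' i, S.Qz i * (v i * f i) - l * ∑' i, S.Qz i * v i ^ 2 := by
    have h1 : ∀ i, S.Qz i * (v i * S.L v i) = l * (S.Qz i * v i ^ 2) - S.Qz i * (v i * f i) := by
      intro i
      by_cases hi : (i : ℕ) ≤ n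
      · linear_combination (-(S.Qz i * v i)) * heq i hi
      · rw [hn i (not_le.1 hi)]; ring
    rw [tsum_congr h1, (q1.mul_left l).tsum_sub q3, tsum_mul_left] at d2
    linarith
  have hyoung : 2 * (l + g) * ∑' i, S.Qz i * (v i * f i)
      ≤ (l + g) ^ 2 * ∑' i, S.Qz i * v i ^ 2 + ∑' i, S.Qz i * f i ^ 2 := by
    rw [← tsum_mul_left, ← tsum_mul_left, ← (q1.mul_left ((l + g) ^ 2)).tsum_add hf]
    refine (q3.mul_left _).tsum_le_tsum (fun i => ?_) ((q1.mul_left _).add hf)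
    have h1 : 0 ≤ S.Qz i * ((l + g) * v i - f i) ^ 2 :=
      mul_nonneg (S.Qz_pos i).le (sq_nonneg _)
    nlinarith
  rw [hnorm, hdir, hdv] at hgap
  have h1 : (l + g) * ∑' i, S.Qz i * v i ^ 2 ≤ ∑' i, S.Qz i * (v i * f i)
      + (2 * c * S.z * S.L v 1 + c ^ 2 * S.dirichlet e
        + g * (2 * c * S.z * v 1 - c ^ 2 * S.z)) := by linarith
  have h2 := mul_le_mul_of_nonneg_left h1 (by positivity : 0 ≤ 2 * (l + g))
  nlinarith

/-- The unweighted `ℓ²`, identified with `ℓ²(𝒬)` through `y_i = √𝒬_i h_i`. -/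
abbrev Ell2 : Type := lp (fun _ : ℕ+ => ℝ) 2

theorem Ell2.summable_sq (y : Ell2) : Summable fun i => y i ^ 2 := by
  simpa using (lp.memℓp y).summable (by simp)

theorem Ell2.norm_sq (y : Ell2) : ‖y‖ ^ 2 = ∑' i, y i ^ 2 := by
  have := lp.norm_rpow_eq_tsum (p := 2) (by simp) y
  simpa using this

/-- The square summable sequence with given square summable coordinates. -/
def mkEll2 (y : ℕ+ → ℝ) (hy : Summable fun i => y i ^ 2) : Ell2 :=
  ⟨y, memℓp_gen (by simpa using hy)⟩

theorem Subcritical.summable_iota (hS : S.Subcritical η) (y : Ell2) :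
    (Summable fun i => S.weight η i * |y i / √(S.Qz i)|) ∧
    ∑' i, S.weight η i * |y i / √(S.Qz i)|
      ≤ ((∑' i : ℕ+, Real.exp (2 * η * i) * S.Qz i) + 1) / 2 * ‖y‖ := by
  rcases (norm_nonneg y).eq_or_lt with h0 | h0
  · have : y = 0 := norm_eq_zero.1 h0.symm
    simp [this]
  -- The arithmetic-geometric mean inequality, scaled by `t = ‖y‖` to give a bound linear in `‖y‖`.
  set t := ‖y‖ with ht
  have hy := y.summable_sq
  have hle : ∀ i, S.weight η i * |y i / √(S.Qz i)|
      ≤ t / 2 * (Real.exp (2 * η * i) * S.Qz i) + (2 * t)⁻¹ * y i ^ 2 := by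
    intro i
    have hq := S.Qz_pos i
    have hs : 0 < √(S.Qz i) := Real.sqrt_pos.2 hq
    have e1 : Real.exp (2 * η * i) = Real.exp (η * i) ^ 2 := by
      rw [← Real.exp_nat_mul]; push_cast; ring_nf
    have e2 : S.Qz i = √(S.Qz i) ^ 2 := (Real.sq_sqrt hq.le).symm
    set x := Real.exp (η * i)
    set r := √(S.Qz i)
    have e3 : S.weight η i * |y i / r| = x * r * |y i| := by
      rw [weight, abs_div, abs_of_pos hs, e2]
      change x * r ^ 2 * (|y i| / r) = _
      field_simp
    rw [e3, e1, e2, ← sq_abs (y i)]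
    have h1 : t / 2 * (x ^ 2 * r ^ 2) + (2 * t)⁻¹ * |y i| ^ 2 - x * r * |y i|
        = (2 * t)⁻¹ * (t * (x * r) - |y i|) ^ 2 := by field_simp; ring
    have h2 : 0 ≤ (2 * t)⁻¹ * (t * (x * r) - |y i|) ^ 2 := by positivity
    linarith
  have hsum := (hS.summable_exp.mul_left (t / 2)).add (hy.mul_left (2 * t)⁻¹)
  have hs := Summable.of_nonneg_of_le
    (fun i => mul_nonneg (S.weight_pos η i).le (abs_nonneg _)) hle hsum
  refine ⟨hs, (hs.tsum_le_tsum hle hsum).trans (le_of_eq ?_)⟩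
  rw [(hS.summable_exp.mul_left (t / 2)).tsum_add (hy.mul_left (2 * t)⁻¹), tsum_mul_left,
    tsum_mul_left, ← y.norm_sq, ← ht]
  field_simp

/-- The embedding of `ℓ²(𝒬)` into `X`; it is here that `2 η < log (z_s / z)` is needed. -/
def Subcritical.iota (hS : S.Subcritical η) : Ell2 →L[ℝ] S.X η :=
  LinearMap.mkContinuous
    { toFun := fun y => mkX (fun i => y i / √(S.Qz i)) (hS.summable_iota y).1
      map_add' := fun x y => X_ext fun i => by
        rw [X_add_apply, mkX_apply, mkX_apply, mkX_apply, lp.coeFn_add, Pi.add_apply, add_div]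
      map_smul' := fun c x => X_ext fun i => by
        rw [RingHom.id_apply, X_smul_apply, mkX_apply, mkX_apply, lp.coeFn_smul, Pi.smul_apply,
          smul_eq_mul, mul_div_assoc] } _ fun y => (hS.summable_iota y).2

theorem Subcritical.iota_apply (hS : S.Subcritical η) (y : Ell2) (i : ℕ+) :
    hS.iota y i = y i / √(S.Qz i) := rfl

theorem Subcritical.summable_mass (hS : S.Subcritical η) (h : S.X η) :
    (Summable fun i : ℕ+ => (i : ℝ) * S.Qz i * h i) ∧
      ‖∑' i : ℕ+, (i : ℝ) * S.Qz i * h i‖ ≤ η⁻¹ * ‖h‖ := by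
  have hle : ∀ i : ℕ+, ‖(i : ℝ) * S.Qz i * h i‖ ≤ η⁻¹ * (S.weight η i * |h i|) := fun i => by
    have h1 := S.weight_pos η i
    have h2 := exp_neg_mul_cast_le hS.eta_pos i
    rw [Real.norm_eq_abs, abs_mul, abs_of_pos (mul_pos (by positivity) (S.Qz_pos i)),
      S.Qz_eq_weight η i]
    calc _ = (Real.exp (-(η * i)) * i) * (S.weight η i * |h i|) := by ring
      _ ≤ _ := by gcongr
  have hs := (S.X_summable h).mul_left η⁻¹
  refine ⟨Summable.of_norm_bounded hs hle, ?_⟩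
  rw [X_norm_eq, ← tsum_mul_left]
  exact tsum_of_norm_bounded hs.hasSum hle

/-- The mass `∑ i 𝒬_i h_i` as a functional on `X`. -/
def Subcritical.mass (hS : S.Subcritical η) : S.X η →L[ℝ] ℝ :=
  LinearMap.mkContinuous
    { toFun := fun h => ∑' i : ℕ+, (i : ℝ) * S.Qz i * h i
      map_add' := fun f g => by
        rw [← (hS.summable_mass f).1.tsum_add (hS.summable_mass g).1]
        exact tsum_congr fun i => by rw [X_add_apply, mul_add]
      map_smul' := fun c f => by
        rw [RingHom.id_apply, smul_eq_mul, ← tsum_mul_left]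
        exact tsum_congr fun i => by rw [X_smul_apply]; ring } _ fun h => (hS.summable_mass h).2

theorem Subcritical.mass_apply (hS : S.Subcritical η) (h : S.X η) :
    hS.mass h = ∑' i : ℕ+, (i : ℝ) * S.Qz i * h i := rfl

/-- The coordinate functionals on `X`. -/
def coord (S : BeckerDoring) (η : ℝ) (i : ℕ+) : S.X η →L[ℝ] ℝ :=
  LinearMap.mkContinuous
    { toFun := fun h => h i
      map_add' := fun _ _ => rfl
      map_smul' := fun _ _ => rfl } (S.weight η i)⁻¹ fun h => by
    rw [← div_eq_inv_mul, le_div_iff₀' (S.weight_pos η i)]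
    exact weight_mul_abs_le_norm h i

theorem coord_apply (i : ℕ+) (h : S.X η) : coord S η i h = h i := rfl

/-- If the solutions of the truncated resolvent equations with a right-hand side in `ℓ²(𝒬)` converge
in `X` to a limit of zero mass, then that limit lies in `ℓ²(𝒬)`, with the bound that the spectral
gap predicts. -/
theorem Subcritical.exists_iota_eq_of_galerkin (hS : S.Subcritical η) {l : ℝ} (hl : 0 < l)
    {y : Ell2} {h : S.X η} (hm : hS.mass h = 0) {v : ℕ → S.X η} (hv : Tendsto v atTop (𝓝 h))
    (hv0 : ∀ (n : ℕ) (i : ℕ+), n < (i : ℕ) → v n i = 0)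
    (heq : ∀ (n : ℕ) (i : ℕ+), (i : ℕ) ≤ n → l * v n i - S.L (v n) i = hS.iota y i) :
    ∃ y', hS.iota y' = h ∧ ‖y'‖ ≤ ‖y‖ / (l + S.spectralGap) := by
  set g := S.spectralGap with hg
  have hg0 : 0 < g := hS.spectralGap_pos
  have hz := S.z_pos
  have hyf : ∀ i, S.Qz i * hS.iota y i ^ 2 = y i ^ 2 := fun i => by
    have hq := S.Qz_pos i
    rw [iota_apply, div_pow, Real.sq_sqrt hq.le]; field_simp
  have hfs : Summable fun i => S.Qz i * hS.iota y i ^ 2 :=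
    y.summable_sq.congr fun i => (hyf i).symm
  have hfn : ∑' i, S.Qz i * hS.iota y i ^ 2 = ‖y‖ ^ 2 := by
    rw [y.norm_sq]; exact tsum_congr hyf
  have hvi : ∀ i, Tendsto (fun n => v n i) atTop (𝓝 (h i)) := fun i =>
    ((coord S η i).continuous.tendsto _).comp hv
  set c : ℕ → ℝ := fun n => hS.mass (v n) / S.z with hc
  have hclim : Tendsto c atTop (𝓝 0) := by
    have := ((hS.mass.continuous.tendsto _).comp hv).div_const S.z
    rwa [hm, zero_div] at this
  set D := S.dirichlet (fun i => if i = 1 then 1 else 0)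
  set ε : ℕ → ℝ := fun n => 2 * c n * S.z * (l * v n 1 - hS.iota y 1) + c n ^ 2 * D
    + g * (2 * c n * S.z * v n 1 - c n ^ 2 * S.z) with hε
  have hεlim : Tendsto ε atTop (𝓝 0) := by
    have h1 := hvi 1
    have := ((((hclim.const_mul 2).mul_const S.z).mul
      ((h1.const_mul l).sub_const (hS.iota y 1))).add ((hclim.pow 2).mul_const D)).add
      (((((hclim.const_mul 2).mul_const S.z).mul h1).sub ((hclim.pow 2).mul_const S.z)).const_mul g)
    simpa using this
  have hbd : ∀ n, 1 ≤ n → (l + g) ^ 2 * ∑' i, S.Qz i * v n i ^ 2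
      ≤ ‖y‖ ^ 2 + 2 * (l + g) * ε n := fun n h1 => by
    have h2 := hS.energy_bound hl (hv0 n) (heq n) hfs (c := c n)
      (by rw [hc, ← hS.mass_apply]; field_simp)
    have h3 : S.L (v n) 1 = l * v n 1 - hS.iota y 1 := by rw [← heq n 1 (by simpa using h1)]; ring
    rw [hfn, h3] at h2
    exact h2
  have hfin : ∀ s : Finset ℕ+, ∑ i ∈ s, (√(S.Qz i) * h i) ^ 2 ≤ (‖y‖ / (l + g)) ^ 2 := by
    intro s
    have h1 : Tendsto (fun n => ∑ i ∈ s, (√(S.Qz i) * v n i) ^ 2) atTop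
        (𝓝 (∑ i ∈ s, (√(S.Qz i) * h i) ^ 2)) :=
      tendsto_finsetSum _ fun i _ => ((hvi i).const_mul _).pow 2
    have h2 : Tendsto (fun n => (‖y‖ ^ 2 + 2 * (l + g) * ε n) / (l + g) ^ 2) atTop
        (𝓝 ((‖y‖ / (l + g)) ^ 2)) := by
      have := ((hεlim.const_mul (2 * (l + g))).const_add (‖y‖ ^ 2)).div_const ((l + g) ^ 2)
      rwa [mul_zero, add_zero, ← div_pow] at this
    refine le_of_tendsto_of_tendsto h1 h2 ?_
    filter_upwards [eventually_ge_atTop 1] with n hn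
    rw [le_div_iff₀ (by positivity), mul_comm]
    refine le_trans ?_ (hbd n hn)
    gcongr
    have hs : Summable fun i => S.Qz i * v n i ^ 2 :=
      summable_of_support_le fun i hi => by rw [hv0 n i hi]; simp
    refine le_trans (le_of_eq (Finset.sum_congr rfl fun i _ => ?_))
      (hs.sum_le_tsum s fun i _ => mul_nonneg (S.Qz_pos i).le (sq_nonneg _))
    rw [mul_pow, Real.sq_sqrt (S.Qz_pos i).le]
  have hs : Summable fun i => (√(S.Qz i) * h i) ^ 2 :=
    summable_of_sum_le (fun i => sq_nonneg _) hfin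
  refine ⟨mkEll2 _ hs, X_ext fun i => ?_, ?_⟩
  · have : √(S.Qz i) ≠ 0 := (Real.sqrt_pos.2 (S.Qz_pos i)).ne'
    rw [iota_apply]
    change √(S.Qz i) * h i / √(S.Qz i) = h i
    field_simp
  · refine le_of_sq_le_sq ?_ (by positivity)
    rw [Ell2.norm_sq]
    exact hs.tsum_le_of_sum_le hfin

end BeckerDoring

/-! ### Resolvents of the generator and of its dissipative part -/

namespace BeckerDoring

variable {S : BeckerDoring} {η : ℝ}

/-- `R` is the resolvent of `Λ` at `l`, and the limit of the resolvents of the truncations. -/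
structure IsResolventAt (l : ℝ) (R : S.X η →L[ℝ] S.X η) : Prop where
  inX1 : ∀ f, S.InX1 η (R f)
  right_inv : ∀ f i, l * R f i - S.L (R f) i = f i
  unique : ∀ f h : S.X η, S.InX1 η h → (∀ i, l * h i - S.L h i = f i) → h = R f
  galerkin : ∀ f, ∃ v : ℕ → S.X η, Tendsto v atTop (𝓝 (R f)) ∧
    (∀ (n : ℕ) (i : ℕ+), n < (i : ℕ) → v n i = 0) ∧
    ∀ (n : ℕ) (i : ℕ+), (i : ℕ) ≤ n → l * v n i - S.L (v n) i = f i

variable {o : ℕ+ → ℝ} {κ : ℝ}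

theorem one_add_le_mul_add {l s t : ℝ} (hl : 0 < l) (hs : 0 ≤ s) (ht : l + s ≤ t) :
    1 + s ≤ (1 + l⁻¹) * t := by
  have h1 : 1 + s ≤ (1 + l⁻¹) * (l + s) := by
    have h2 : (1 + l⁻¹) * (l + s) = 1 + s + (l + l⁻¹ * s) := by field_simp; ring
    have h3 : 0 ≤ l + l⁻¹ * s := by positivity
    linarith
  exact h1.trans (by gcongr)

theorem IsGainBound.exists_isResolventAt (ho : S.IsGainBound η o) (hκ0 : 0 < κ) (hκ1 : κ < 1)
    (hev : ∀ᶠ i in atTop, o i ≤ κ * S.sigma i) :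
    ∃ ω, 0 < ω ∧ ∃ R : ℝ → S.X η →L[ℝ] S.X η, ∀ l, ω < l → IsResolventAt l (R l) := by
  obtain ⟨N, hN⟩ := eventually_atTop.1 hev
  have hsum0 : 0 ≤ ∑ i ∈ Finset.Iio N, o i := Finset.sum_nonneg fun i _ => ho.nonneg i
  set ω := 1 + (∑ i ∈ Finset.Iio N, o i) / κ with hω
  have hω0 : 0 < ω := by positivity
  have hR : ∀ l, ∃ R : S.X η →L[ℝ] S.X η, ω < l → IsResolventAt l R := by
    intro l
    by_cases hl : ω < l
    · have hl0 : 0 < l := hω0.trans hl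
      have hop : ∀ i, o i ≤ κ * (l + S.sigma i) := fun i => by
        have hs := S.sigma_pos i
        by_cases hi : i < N
        · have h1 : o i ≤ ∑ i ∈ Finset.Iio N, o i :=
            Finset.single_le_sum (fun j _ => ho.nonneg j) (Finset.mem_Iio.2 hi)
          have h2 : κ * ω = κ + ∑ i ∈ Finset.Iio N, o i := by rw [hω]; field_simp
          have h3 : κ * ω ≤ κ * (l + S.sigma i) := by gcongr; linarith
          linarith
        · refine (hN i (not_lt.1 hi)).trans ?_
          gcongr
          linarith
      obtain ⟨R, h1, h2, h3, -, h5⟩ := ho.exists_resolvent (p := fun i => l + S.sigma i) hκ1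
        (fun i => by linarith [S.sigma_pos i])
        (fun i => one_add_le_mul_add hl0 (S.sigma_pos i).le le_rfl) hop
      refine ⟨R, fun _ => ⟨h1, fun f i => ?_, fun f h hh hf => ?_, fun f => ?_⟩⟩
      · linarith [h2 f i]
      · exact h3 f h hh fun i => by linarith [hf i]
      · obtain ⟨v, hv1, hv2, hv3⟩ := h5 f
        exact ⟨v, hv1, hv2, fun n i hi => by linarith [hv3 n i hi]⟩
    · exact ⟨0, fun h => absurd h hl⟩
  choose R hR using hR
  exact ⟨ω, hω0, R, hR⟩

/-- Strengthening the diagonal in finitely many coordinates makes the operator dissipative in `X`,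
with any rate that `(1 - κ) σ` exceeds at infinity. -/
theorem IsGainBound.exists_dissipative (ho : S.IsGainBound η o) (hκ0 : 0 < κ) (hκ1 : κ < 1)
    (hev : ∀ᶠ i in atTop, o i ≤ κ * S.sigma i) {μ : ℝ} (hμ0 : 0 < μ)
    (hμ : ∀ᶠ i in atTop, μ ≤ (1 - κ) * S.sigma i) :
    ∃ (N : ℕ+) (M : ℝ), ∀ l, 0 < l → ∃ RB : S.X η →L[ℝ] S.X η,
      (∀ f, ‖RB f‖ ≤ ‖f‖ / (l + μ)) ∧ ∀ f, S.InX1 η (RB f) ∧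
        ∀ i, l * RB f i + (if i < N then M else 0) * RB f i - S.L (RB f) i = f i := by
  obtain ⟨N, hN⟩ := eventually_atTop.1 (hev.and hμ)
  have hsum0 : 0 ≤ ∑ i ∈ Finset.Iio N, o i := Finset.sum_nonneg fun i _ => ho.nonneg i
  set M := μ + (∑ i ∈ Finset.Iio N, o i) / κ with hM
  have hM0 : 0 < M := by positivity
  have hoM : ∀ i, i < N → o i + κ * μ ≤ κ * M ∧ o i + μ ≤ M := fun i hi => by
    have h1 : o i ≤ ∑ i ∈ Finset.Iio N, o i :=
      Finset.single_le_sum (fun j _ => ho.nonneg j) (Finset.mem_Iio.2 hi)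
    have h2 : κ * M = κ * μ + ∑ i ∈ Finset.Iio N, o i := by rw [hM]; field_simp
    have h3 : ∑ i ∈ Finset.Iio N, o i ≤ (∑ i ∈ Finset.Iio N, o i) / κ :=
      le_div_self hsum0 hκ0 hκ1.le
    constructor <;> linarith
  refine ⟨N, M, fun l hl => ?_⟩
  set p : ℕ+ → ℝ := fun i => l + S.sigma i + if i < N then M else 0 with hp
  have hpl : ∀ i, l + S.sigma i ≤ p i := fun i => by
    simp only [hp]; split_ifs <;> linarith
  have hop : ∀ i, o i ≤ κ * p i := fun i => by
    have hs := S.sigma_pos i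
    by_cases hi : i < N
    · have h1 := (hoM i hi).1
      have h2 : p i = l + S.sigma i + M := by simp only [hp]; rw [if_pos hi]
      rw [h2]
      nlinarith [mul_pos hκ0 hl, mul_pos hκ0 hs, mul_pos hκ0 hμ0]
    · refine (hN i (not_lt.1 hi)).1.trans ?_
      gcongr
      linarith [hpl i]
  have hoμ : ∀ i, o i + (l + μ) ≤ p i := fun i => by
    have hs := S.sigma_pos i
    by_cases hi : i < N
    · have h1 := (hoM i hi).2
      have h2 : p i = l + S.sigma i + M := by simp only [hp]; rw [if_pos hi]
      linarith
    · obtain ⟨h1, h2⟩ := hN i (not_lt.1 hi)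
      linarith [hpl i]
  obtain ⟨R, h1, h2, -, h4, -⟩ := ho.exists_resolvent (p := p) hκ1
    (fun i => by linarith [S.sigma_pos i, hpl i])
    (fun i => one_add_le_mul_add hl (S.sigma_pos i).le (hpl i)) hop
  refine ⟨R, h4 (l + μ) (by positivity) hoμ, fun f => ⟨h1 f, fun i => ?_⟩⟩
  have := h2 f i
  simp only [hp] at this
  linarith

/-- Multiplication by `M` in the coordinates below `N`, as an operator from `X` to `ℓ²(𝒬)`. -/
def cutoff (S : BeckerDoring) (η : ℝ) (N : ℕ+) (M : ℝ) : S.X η →L[ℝ] Ell2 :=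
  ∑ i ∈ Finset.Iio N, (coord S η i).smulRight (lp.single 2 i (M * √(S.Qz i)))

namespace Subcritical

theorem iota_cutoff (hS : S.Subcritical η) (N : ℕ+) (M : ℝ) (h : S.X η) (i : ℕ+) :
    hS.iota (cutoff S η N M h) i = (if i < N then M else 0) * h i := by
  have hq : √(S.Qz i) ≠ 0 := (Real.sqrt_pos.2 (S.Qz_pos i)).ne'
  have h1 : (cutoff S η N M h : Ell2) i = (if i < N then M * √(S.Qz i) else 0) * h i := by
    rw [cutoff, sum_apply, lp.coeFn_sum, Finset.sum_apply]
    simp only [ContinuousLinearMap.smulRight_apply, lp.coeFn_smul, Pi.smul_apply, coord_apply,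
      lp.single_apply, smul_eq_mul]
    by_cases hi : i < N
    · rw [Finset.sum_eq_single_of_mem i (Finset.mem_Iio.2 hi)]
      · simp [hi, mul_comm]
      · intro j _ hj
        simp [Pi.single_eq_of_ne hj.symm]
    · rw [if_neg hi, zero_mul]
      refine Finset.sum_eq_zero fun j hj => ?_
      have hij : i ≠ j := by rintro rfl; exact hi (Finset.mem_Iio.1 hj)
      simp [Pi.single_eq_of_ne hij]
  rw [iota_apply, h1]
  split_ifs
  · field_simp
  · simp

/-- The second moment of the equilibrium, which is the mass of the equilibrium `h_i = i`. -/
theorem tsum_sq_Qz_pos (hS : S.Subcritical η) : 0 < ∑' i : ℕ+, (i : ℝ) ^ 2 * S.Qz i :=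
  hS.summable_sq_Qz.tsum_pos (fun i => mul_nonneg (sq_nonneg _) (S.Qz_pos i).le) 1
    (by simpa using S.Qz_pos 1)

/-- The equilibrium `h_i = i`, normalized to mass one, in `ℓ²(𝒬)`. -/
def equilibrium (hS : S.Subcritical η) : Ell2 :=
  mkEll2 (fun i => √(S.Qz i) * (i / ∑' j : ℕ+, (j : ℝ) ^ 2 * S.Qz j)) <|
    (hS.summable_sq_Qz.mul_right (((∑' j : ℕ+, (j : ℝ) ^ 2 * S.Qz j) ^ 2)⁻¹)).congr fun i => by
      rw [mul_pow, Real.sq_sqrt (S.Qz_pos i).le, div_pow]; ring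

theorem iota_equilibrium (hS : S.Subcritical η) (i : ℕ+) :
    hS.iota hS.equilibrium i = i / ∑' j : ℕ+, (j : ℝ) ^ 2 * S.Qz j := by
  have hq : √(S.Qz i) ≠ 0 := (Real.sqrt_pos.2 (S.Qz_pos i)).ne'
  rw [iota_apply]
  exact mul_div_cancel_left₀ _ hq

theorem mass_equilibrium (hS : S.Subcritical η) : hS.mass (hS.iota hS.equilibrium) = 1 := by
  have h0 := hS.tsum_sq_Qz_pos.ne'
  rw [mass_apply]
  have : ∀ i : ℕ+, (i : ℝ) * S.Qz i * hS.iota hS.equilibrium i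
      = (i : ℝ) ^ 2 * S.Qz i * (∑' j : ℕ+, (j : ℝ) ^ 2 * S.Qz j)⁻¹ := fun i => by
    rw [iota_equilibrium]; ring
  rw [tsum_congr this, tsum_mul_right, mul_inv_cancel₀ h0]

theorem inX1_equilibrium (hS : S.Subcritical η) : S.InX1 η (hS.iota hS.equilibrium) := by
  obtain ⟨C, hC, hσ⟩ := S.exists_sigma_le
  have h0 := hS.tsum_sq_Qz_pos
  set m := ∑' j : ℕ+, (j : ℝ) ^ 2 * S.Qz j with hm
  refine (hS.summable_weight_of_abs_le (f := fun i => (1 + S.sigma i) * (i / m)) (C := C / m)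
    fun i => ?_).congr fun i => ?_
  · have h1 := S.sigma_pos i
    rw [abs_of_nonneg (by positivity)]
    calc (1 + S.sigma i) * (i / m) ≤ C * (1 + S.a i + S.b i) * (i / m) := by gcongr; exact hσ i
      _ = _ := by ring
  · rw [iota_equilibrium, ← hm, abs_of_nonneg (by positivity)]
    ring

theorem L_equilibrium (hS : S.Subcritical η) (i : ℕ+) :
    S.L (hS.iota hS.equilibrium) i = 0 := by
  have hW : ∀ k, S.W (hS.iota hS.equilibrium) k = 0 := fun k => by
    rw [W_eq]
    simp only [iota_equilibrium]
    push_cast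
    ring
  simp [L, hW]

variable {l : ℝ} {R : S.X η →L[ℝ] S.X η}

theorem mass_resolvent (hS : S.Subcritical η) (hl : 0 < l) (hR : IsResolventAt l R) (f : S.X η) :
    hS.mass (R f) = l⁻¹ * hS.mass f := by
  have h1 : hS.mass (l • R f - f) = 0 := by
    rw [mass_apply, ← (hR.inX1 f).tsum_mass_L hS]
    refine tsum_congr fun i => ?_
    rw [X_sub_apply, X_smul_apply, ← hR.right_inv f i, sub_sub_cancel]
  rw [map_sub, map_smul, smul_eq_mul] at h1
  field_simp
  linarith

theorem resolvent_equilibrium (hS : S.Subcritical η) (hl : 0 < l) (hR : IsResolventAt l R) :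
    R (hS.iota hS.equilibrium) = l⁻¹ • hS.iota hS.equilibrium := by
  symm
  refine hR.unique _ _ (mem_X1_iff.1 ((S.X1 η).smul_mem _ (mem_X1_iff.2 hS.inX1_equilibrium)))
    fun i => ?_
  have h1 := L_smul (S := S) l⁻¹ (hS.iota hS.equilibrium) i
  rw [hS.L_equilibrium, mul_zero] at h1
  have h2 : S.L (l⁻¹ • hS.iota hS.equilibrium : S.X η) i = 0 := h1
  rw [h2, X_smul_apply, sub_zero, mul_inv_cancel_left₀ hl.ne']

theorem exists_iota_eq_resolvent (hS : S.Subcritical η) (hl : 0 < l) (hR : IsResolventAt l R)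
    (y : Ell2) (hy : hS.mass (hS.iota y) = 0) :
    ∃ y', hS.iota y' = R (hS.iota y) ∧ ‖y'‖ ≤ ‖y‖ / (l + S.spectralGap) := by
  obtain ⟨v, hv1, hv2, hv3⟩ := hR.galerkin (hS.iota y)
  exact hS.exists_iota_eq_of_galerkin hl (by rw [hS.mass_resolvent hl hR, hy, mul_zero]) hv1 hv2 hv3

/-- Decay of the powers of the resolvent on sequences of zero mass, at any rate `r ≤ λ₀` below a
rate `μ` that `(1 - κ) σ` exceeds at infinity. -/
theorem exists_norm_resolvent_pow_le (hS : S.Subcritical η) (ho : S.IsGainBound η o)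
    (hκ0 : 0 < κ) (hκ1 : κ < 1) (hev : ∀ᶠ i in atTop, o i ≤ κ * S.sigma i) {μ r : ℝ}
    (hμ : ∀ᶠ i in atTop, μ ≤ (1 - κ) * S.sigma i) (hr0 : 0 ≤ r) (hrμ : r < μ)
    (hr : r ≤ S.spectralGap) {ω : ℝ} (hω : 0 < ω) {R : ℝ → S.X η →L[ℝ] S.X η}
    (hR : ∀ l, ω < l → IsResolventAt l (R l)) :
    ∃ C : ℝ, 0 < C ∧ ∀ g, hS.mass g = 0 → ∀ l, ω < l → ∀ k : ℕ,
      ‖(R l ^ k) g‖ ≤ C * ‖g‖ * ((l + r)⁻¹) ^ k := by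
  obtain ⟨N, M, hNM⟩ := ho.exists_dissipative hκ0 hκ1 hev (hr0.trans_lt hrμ) hμ
  have hRB : ∀ l, ∃ RB : S.X η →L[ℝ] S.X η, ω < l → (∀ f, ‖RB f‖ ≤ ‖f‖ / (l + μ)) ∧
      ∀ f, S.InX1 η (RB f) ∧
        ∀ i, l * RB f i + (if i < N then M else 0) * RB f i - S.L (RB f) i = f i := fun l => by
    by_cases hl : ω < l
    · obtain ⟨RB, h⟩ := hNM l (hω.trans hl)
      exact ⟨RB, fun _ => h⟩
    · exact ⟨0, fun h => absurd h hl⟩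
  choose RB hRB using hRB
  refine _root_.exists_norm_resolvent_pow_le (ι := hS.iota) (A := cutoff S η N M) (m := hS.mass)
    (eH := hS.equilibrium) hS.mass_equilibrium (RB := RB) hω.le hr0 hr hrμ
    (fun l hl => hS.resolvent_equilibrium (hω.trans hl) (hR l hl)) (fun l hl => (hRB l hl).1)
    (fun l hl x => ?_) (fun l hl => hS.exists_iota_eq_resolvent (hω.trans hl) (hR l hl))
    (fun l hl => hS.mass_resolvent (hω.trans hl) (hR l hl))
  obtain ⟨h1, h2⟩ := (hRB l hl).2 x
  have h3 : RB l x = R l (x - hS.iota (cutoff S η N M (RB l x))) :=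
    (hR l hl).unique _ _ h1 fun i => by
      rw [X_sub_apply, iota_cutoff, ← h2 i]; ring
  rw [map_sub] at h3
  exact (sub_eq_iff_eq_add.1 h3.symm)

/-- The hypotheses of the Hille–Yosida theorem: on the complement of the zero mass sequences, which
is spanned by the equilibrium, `R l` is multiplication by `1 / l`. -/
theorem exists_isBoundedResolvent (hS : S.Subcritical η) (ho : S.IsGainBound η o) {ω C r : ℝ}
    (hω : 0 < ω) (hC : 0 < C) (hr : 0 ≤ r) {R : ℝ → S.X η →L[ℝ] S.X η}
    (hR : ∀ l, ω < l → IsResolventAt l (R l))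
    (hpow : ∀ g, hS.mass g = 0 → ∀ l, ω < l → ∀ k : ℕ,
      ‖(R l ^ k) g‖ ≤ C * ‖g‖ * ((l + r)⁻¹) ^ k) :
    ∃ M, 0 ≤ M ∧ IsBoundedResolvent ho.generator ω M R := by
  set e := hS.iota hS.equilibrium with he
  set q := ‖hS.mass‖ * ‖e‖ with hq
  have hq0 : 0 ≤ q := by positivity
  refine ⟨C * (1 + q) + q, by positivity, ⟨hω.le, fun l hl f => ?_, fun l hl f g hfg => ?_,
    fun l hl k x => ?_⟩⟩
  · refine ho.mem_graph_iff.2 ⟨(hR l hl).inX1 f, fun i => ?_⟩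
    rw [X_sub_apply, X_smul_apply, ← (hR l hl).right_inv f i]; ring
  · obtain ⟨h1, h2⟩ := ho.mem_graph_iff.1 hfg
    exact ((hR l hl).unique _ _ h1 fun i => by rw [h2, X_sub_apply, X_smul_apply]).symm
  · have hl0 : 0 < l := hω.trans hl
    have hek : (R l ^ k) e = (l⁻¹) ^ k • e := by
      induction k with
      | zero => simp
      | succ k ih =>
        rw [pow_succ', mul_apply_eq_comp, ih, map_smul, hS.resolvent_equilibrium hl0 (hR l hl),
          smul_smul, pow_succ]
    have hm : hS.mass (x - hS.mass x • e) = 0 := by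
      rw [map_sub, map_smul, he, hS.mass_equilibrium]; simp
    have hme : ‖hS.mass x • e‖ ≤ q * ‖x‖ := by
      rw [norm_smul]
      calc _ ≤ ‖hS.mass‖ * ‖x‖ * ‖e‖ := by gcongr; exact hS.mass.le_opNorm x
        _ = q * ‖x‖ := by rw [hq]; ring
    have h1 : (R l ^ k) x = (R l ^ k) (x - hS.mass x • e) + (l⁻¹) ^ k • (hS.mass x • e) := by
      rw [map_sub, map_smul, hek, smul_comm]; abel
    have h2 : ((l + r)⁻¹) ^ k ≤ (l⁻¹) ^ k := by gcongr; linarith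
    have h3 : ‖x - hS.mass x • e‖ ≤ (1 + q) * ‖x‖ := (norm_sub_le _ _).trans (by linarith)
    rw [h1]
    refine (norm_add_le _ _).trans ?_
    rw [norm_smul ((l⁻¹) ^ k), Real.norm_of_nonneg (by positivity)]
    calc _ ≤ C * ((1 + q) * ‖x‖) * (l⁻¹) ^ k + (l⁻¹) ^ k * (q * ‖x‖) := by
          gcongr
          exact (hpow _ hm l hl k).trans (by gcongr)
      _ = _ := by ring

end Subcritical
end BeckerDoring

theorem mainTheorem3 (S : BeckerDoring)
    (hA : Summable fun i : ℕ+ => (i : ℝ) ^ 2 * (1 + S.a i + S.b i) ^ 2 * S.Qz i)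
    (ha_inf : 0 < ⨅ i, S.a i)
    (hQ : Tendsto (fun i : ℕ+ => ENNReal.ofReal (S.Q (i + 1) / S.Q i)) atTop (𝓝 S.zs⁻¹))
    (ha_lim : Tendsto (fun i : ℕ+ => S.a (i + 1) / S.a i) atTop (𝓝 1))
    (hz : ENNReal.ofReal S.z < S.zs)
    (η : ℝ) (hη : 0 < η)
    (hη' : (η : EReal) < ((1 / 2 : ℝ) : EReal) * ENNReal.log (S.zs / ENNReal.ofReal S.z)) :
    ∃ Λ : S.X η →ₗ.[ℝ] S.X η,
      Λ.domain = S.X1 η ∧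
      (∀ h : Λ.domain, Summable (S.W (h : S.X η)) ∧ ∀ i, Λ h i = S.L (h : S.X η) i) ∧
      ∃ T : C0Semigroup (S.X η), T.IsGenerator Λ ∧
        (∃ l : ℝ, 0 < l ∧ l ≤ S.spectralGap ∧ ∃ C : ℝ, 0 < C ∧
          ∀ (t : ℝ≥0) (g : S.X η), ∑' i : ℕ+, (i : ℝ) * S.Qz i * g i = 0 →
            ‖T.op t g‖ ≤ C * Real.exp (-l * t) * ‖g‖) ∧
        (Tendsto S.a atTop atTop →
          ∃ C : ℝ, 0 < C ∧
            ∀ (t : ℝ≥0) (g : S.X η), ∑' i : ℕ+, (i : ℝ) * S.Qz i * g i = 0 →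
              ‖T.op t g‖ ≤ C * Real.exp (-S.spectralGap * t) * ‖g‖) := by
  have hS := S.subcritical hA ha_inf hQ ha_lim hη hη'
  obtain ⟨o, κ, ho, hκ0, hκ1, hev⟩ := hS.exists_gainBound
  obtain ⟨ω, hω, R, hR⟩ := ho.exists_isResolventAt hκ0 hκ1 hev
  have hgap := hS.spectralGap_pos
  have hz0 := S.z_pos
  have hκ : 0 < 1 - κ := sub_pos.2 hκ1
  have hσ : ∀ i, S.a i * S.z ≤ S.sigma i := fun i => by
    linarith [S.le_sigma i, S.b_nonneg i]
  obtain ⟨c, hc, hca⟩ := hS.exists_le_a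
  set μ := (1 - κ) * (c * S.z) with hμ
  have hμ0 : 0 < μ := by positivity
  set r := min (μ / 2) S.spectralGap with hr
  have hr0 : 0 < r := lt_min (by positivity) hgap
  obtain ⟨C, hC, hpow⟩ := hS.exists_norm_resolvent_pow_le ho hκ0 hκ1 hev (μ := μ) (r := r)
    (Eventually.of_forall fun i => by
      rw [hμ]
      gcongr
      exact le_trans (by gcongr; exact hca i) (hσ i))
    hr0.le ((min_le_left _ _).trans_lt (half_lt_self hμ0)) (min_le_right _ _) hω hR
  obtain ⟨M, hM, hbd⟩ := hS.exists_isBoundedResolvent ho hω hC hr0.le hR hpow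
  obtain ⟨T, hT, hlim⟩ := hbd.exists_semigroup hM BeckerDoring.dense_X1
  have hdecay : ∀ {C r : ℝ}, 0 ≤ r → (∀ g, hS.mass g = 0 → ∀ l, ω < l → ∀ k : ℕ,
      ‖(R l ^ k) g‖ ≤ C * ‖g‖ * ((l + r)⁻¹) ^ k) → ∀ (t : ℝ≥0) (g : S.X η),
      ∑' i : ℕ+, (i : ℝ) * S.Qz i * g i = 0 → ‖T.op t g‖ ≤ C * Real.exp (-r * t) * ‖g‖ := by
    intro C r hr h t g hg
    rw [mul_right_comm]
    exact norm_le_of_tendsto_exp_yosida t.2 hr (hlim t g) (h g hg)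
  refine ⟨ho.generator, rfl, fun h => ⟨ho.summable_W _ (BeckerDoring.mem_X1_iff.1 h.2),
    fun i => rfl⟩, T, hT, ⟨r, hr0, min_le_right _ _, C, hC, hdecay hr0.le hpow⟩, fun hinf => ?_⟩
  -- If `a` tends to infinity then so does `σ`, and every rate is available.
  have hev' : ∀ᶠ i in atTop, S.spectralGap + 1 ≤ (1 - κ) * S.sigma i := by
    filter_upwards [hinf.eventually_ge_atTop ((S.spectralGap + 1) / ((1 - κ) * S.z))] with i hi
    rw [div_le_iff₀ (by positivity)] at hi
    calc _ ≤ S.a i * ((1 - κ) * S.z) := hi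
      _ = (1 - κ) * (S.a i * S.z) := by ring
      _ ≤ _ := by gcongr; exact hσ i
  obtain ⟨C', hC', hpow'⟩ := hS.exists_norm_resolvent_pow_le ho hκ0 hκ1 hev hev' hgap.le
    (lt_add_one _) le_rfl hω hR
  exact ⟨C', hC', hdecay hgap.le hpow'⟩

end
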